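/- For $m>0$, $r>0$, $\alpha>1$ let $\mathrm{BNB}(m,r,\alpha)$ be the beta negative binomial distribution on $\mathbb N=\{0,1,2,\dots\}$ with probability mass function $$p(k)=\frac{\Gamma(k+r)}{\Gamma(k+1)\Gamma(r)}\,\frac{B\big(\alpha+r,(\alpha-1)m/r+k\big)}{B\big(\alpha,(\alpha-1)m/r\big)},\qquad k\in\mathbb N,$$ where $B$ is Euler's beta function, and let $F_m^{-1}(v)=\inf\{z: v\le F_m(z)\}$, $v\in(0,1)$, be its quantile function, where $F_m$ is its distribution function. Let $\mathbb R^+=(0,\infty)$, $r>0$, $\alpha>1$, let $g:\mathbb N\times\mathbb R^+\to\mathbb R^+$, and suppose that there are constants $c_1,c_2>0$ with $c_1+c_2<1$ and $$|g(y,\lambda)-g(y^*,\lambda^*)|\le c_1|y-y^*|+c_2|\lambda-\lambda^*|\qquad\text{for all }y,y^*\in\mathbb N,\ \lambda,\lambda^*\in\mathbb R^+ .$$ Suppose also that $\lim_{\lambda\downarrow0}g(0,\lambda)>0$ (the limit exists by the previous condition). Consider the BNB autoregression $$y_t\mid\mathcal F_{t-1}\sim \mathrm{BNB}(\lambda_t,r,\alpha),\qquad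 \lambda_{t+1}=g(y_t,\lambda_t)\quad\text{a.s.},\qquad t\in\mathbb Z, \tag{1}$$ for processes $(y_t,\lambda_t)_{t\in\mathbb Z}$ with values in $\mathbb N\times\mathbb R^+$, where $\mathcal F_{t}$ is the $\sigma$-field generated by $y_t,y_{t-1},\dots$. (i) The equations (1) have a strictly stationary and ergodic solution $\{(y_t,\lambda_t)\}_{t\in\mathbb Z}$ with $\mathbb E(y_t)<\infty$, and any strictly stationary solution of (1), on any probability space, has the same law. Moreover, on any probability space that carries a sequence $(u_t)_{t\in\mathbb Z}$ of i.i.d. random variables uniform on $(0,1)$ there is a solution of (1) that is strictly stationary and ergodic, has $\mathbb E(y_t)<\infty$, satisfies $y_t=F_{\lambda_t}^{-1}(u_t)$ a.s. for all $t$, and is causal, that is, $(y_t,\lambda_t)=H(u_t,u_{t-1},\dots)$ a.s. for all $t$, for some measurable function $H$. Up to almost sure equality it is the only strictly stationary causal process with $y_t=F_{\lambda_t}^{-1}(u_t)$ and $\lambda_{t+1}=g(y_t,\lambda_t)$ a.s. for all $t$. (ii) There is a measurable function $g^\infty:\mathbb N^{\mathbb N}\to\mathbb R^+$ such that every strictly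 stationary solution of (1) satisfies $\lambda_t=g^\infty(y_{t-1},y_{t-2},\dots)$ a.s. for all $t\in\mathbb Z$. -/

import Mathlib

open MeasureTheory ProbabilityTheory

universe w

namespace BNB

/-- The half-line `ℝ⁺ = (0, ∞)` in which the conditional mean process takes its values. -/
abbrev PosReal : Type := {x : ℝ // 0 < x}

/-- The probability mass function of the beta negative binomial distribution `BNB(m, r, α)` with
mean `m`, dispersion parameter `r` and tail parameter `α`, where
`B` is Euler's beta function, `B(a, b) = Γ(a) Γ(b) / Γ(a + b)`. -/
noncomputable def pmf (m r α : ℝ) (k : ℕ) : ℝ :=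
  Real.Gamma (k + r) / (Real.Gamma (k + 1) * Real.Gamma r) *
    (beta (α + r) ((α - 1) * m / r + k) / beta α ((α - 1) * m / r))

/-- The cumulative distribution function of `BNB(m, r, α)` at the natural number `n`. -/
noncomputable def cdf (m r α : ℝ) (n : ℕ) : ℝ :=
  ∑ k ∈ Finset.range (n + 1), pmf m r α k

/-- The quantile function `v ↦ inf {z : v ≤ F(z)}`, `v ∈ (0, 1)`, of `BNB(m, r, α)`. For such `v`
the infimum over real `z` is attained at a natural number, because the distribution lives on `ℕ`. -/
noncomputable def quantile (m r α v : ℝ) : ℕ :=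
  sInf {n : ℕ | v ≤ cdf m r α n}

section Processes

variable {Ω S : Type*} [MeasurableSpace Ω] [MeasurableSpace S]

/-- The σ-field generated by `X t, X (t - 1), X (t - 2), …`. -/
@[reducible] def past (X : ℤ → Ω → S) (t : ℤ) : MeasurableSpace Ω :=
  ⨆ (s : ℤ) (_ : s ≤ t), MeasurableSpace.comap (X s) inferInstance

/-- The law of a process, a measure on the space of its two-sided paths. -/
noncomputable def pathLaw (P : Measure Ω) (X : ℤ → Ω → S) : Measure (ℤ → S) :=
  P.map (fun ω t => X t ω)

/-- Strict stationarity: the law of the process is invariant under every time shift. -/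
def StrictlyStationary (P : Measure Ω) (X : ℤ → Ω → S) : Prop :=
  ∀ h : ℤ, pathLaw P (fun t => X (t + h)) = pathLaw P X

/-- The left shift on two-sided paths. -/
def shift (x : ℤ → S) : ℤ → S := fun t => x (t + 1)

/-- A process is (stationary and) ergodic if its law is an ergodic measure of the shift. -/
def ErgodicProcess (P : Measure Ω) (X : ℤ → Ω → S) : Prop :=
  Ergodic shift (pathLaw P X)

/-- The process `u` consists of i.i.d. random variables, uniform on `(0, 1)`. -/
structure IsIIDUniform (P : Measure Ω) (u : ℤ → Ω → ℝ) : Prop where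
  measurable : ∀ t, Measurable (u t)
  indep : iIndepFun u P
  uniform : ∀ t, P.map (u t) = volume.restrict (Set.Ioo 0 1)

/-- `X` is causal with respect to `u`: `X t = H (u t, u (t - 1), …)` for a measurable `H`. -/
def IsCausal (P : Measure Ω) (u : ℤ → Ω → ℝ) (X : ℤ → Ω → S) : Prop :=
  ∃ H : (ℕ → ℝ) → S, Measurable H ∧ ∀ t : ℤ, ∀ᵐ ω ∂P, X t ω = H (fun n : ℕ => u (t - n) ω)

end Processes

section Model

variable {Ω : Type*} [MeasurableSpace Ω]

/-- The pair process `(y t, l t)`. -/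
def pair (y : ℤ → Ω → ℕ) (l : ℤ → Ω → PosReal) : ℤ → Ω → ℕ × PosReal :=
  fun t ω => (y t ω, l t ω)

/-- `(y, l)` solves the equations of the BNB autoregression:
`y t | σ(y (t - 1), y (t - 2), …) ~ BNB(l t, r, α)` and `l (t + 1) = g (y t, l t)`. -/
structure IsSolution (r α : ℝ) (g : ℕ → PosReal → PosReal) (P : Measure Ω)
    (y : ℤ → Ω → ℕ) (l : ℤ → Ω → PosReal) : Prop where
  measurable_y : ∀ t, Measurable (y t)
  measurable_l : ∀ t, Measurable (l t)
  condLaw : ∀ (t : ℤ) (k : ℕ),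
    P[(y t ⁻¹' {k}).indicator (fun _ => (1 : ℝ)) | past y (t - 1)]
      =ᵐ[P] fun ω => pmf (l t ω) r α k
  recursion : ∀ t : ℤ, ∀ᵐ ω ∂P, l (t + 1) ω = g (y t ω) (l t ω)

/-- `(y, l)` solves the equations of the BNB autoregression written with the innovations `u`:
`y t` is the quantile of `BNB(l t, r, α)` at `u t`, and `l (t + 1) = g (y t, l t)`. -/
structure IsDrivenSolution (r α : ℝ) (g : ℕ → PosReal → PosReal) (P : Measure Ω)
    (u : ℤ → Ω → ℝ) (y : ℤ → Ω → ℕ) (l : ℤ → Ω → PosReal) : Prop where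
  measurable_y : ∀ t, Measurable (y t)
  measurable_l : ∀ t, Measurable (l t)
  observation : ∀ t : ℤ, ∀ᵐ ω ∂P, y t ω = quantile (l t ω) r α (u t ω)
  recursion : ∀ t : ℤ, ∀ᵐ ω ∂P, l (t + 1) ω = g (y t ω) (l t ω)

end Model

end BNB

/-!
The beta negative binomial distributions with fixed `r` and `α` have likelihood ratios that increase
with the mean, so they are stochastically ordered by their means and the quantile coupling is
optimal: `E |F_m⁻¹(U) - F_m'⁻¹(U)| = |m - m'|` (`lintegral_quantile_sub`). Hence two copies of the
conditional mean process which share an innovation contract in mean by the factor `c₁ + c₂ < 1`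
(`LipschitzPair.lintegral_le`), although the map from one conditional mean to the next is
discontinuous for a fixed innovation. The contraction is used three times.

* The map `X ↦ (one step of the recursion from X ∘ tail)` is a contraction of `L¹` of the space of
  one-sided innovation sequences. Its fixed point is the conditional mean `h` as a function of the
  past innovations (`exists_mean_function`). The positive limit of `g 0` at `0` extends the recursion
  to the value `0` and keeps the fixed point positive. The causal process built from `h` is a factor
  of the Bernoulli shift, hence stationary and ergodic (`ergodic_shift_infinitePi`).
* Any other measurable function with the same recursion equals `h` almost everywhere: the expected
  distance, rescaled by `d / (1 + d)`, would otherwise strictly decrease although it is constant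
  (`mean_function_unique`). This is the uniqueness of the causal solution.
* The Markov operator of the conditional mean contracts Lipschitz constants, so its iterates flatten
  bounded Lipschitz functions and it has at most one invariant law (`IsInvariantMean.unique`).

In the model equation the conditioning is on past observations, not on past innovations. Since
`c₂ < 1`, iterating `g` backwards along the observations forgets its starting value, so the
conditional mean is a function `pastMean g` of the past observations (`ae_mean_eq_pastMean`), and the
causal process solves the model (`isSolution_causal`). Conversely, in any solution the conditional
mean can be read off from the conditional law, hence is a function of the past observations
(`IsSolution.exists_isPastMean`); the pair is then a Markov chain, and its law is determined by the
invariant law of the conditional mean (`IsSolution.pathLaw_eq`). Because all stationary solutions have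
the same law, the identity `l t = pastMean g (y (t - 1), y (t - 2), …)` passes from the causal
solution to each of them.
-/

namespace BNB

/-! ### The beta negative binomial distribution -/

/-- The beta negative binomial weights in the parametrization `(r, a, b)`, where `b` is the second
parameter of the mixing beta distribution: `pmf m r α` is `weight r α ((α - 1) * m / r)`. -/
noncomputable def weight (r a b : ℝ) (k : ℕ) : ℝ :=
  Real.Gamma (k + r) / (Real.Gamma (k + 1) * Real.Gamma r) * (beta (a + r) (b + k) / beta a b)

lemma weight_pos {r a b : ℝ} (hr : 0 < r) (ha : 0 < a) (hb : 0 < b) (k : ℕ) :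
    0 < weight r a b k := by
  unfold weight
  have h1 := Real.Gamma_pos_of_pos (s := k + r) (by positivity)
  have h2 := Real.Gamma_pos_of_pos (s := k + 1) (by positivity)
  have h3 := Real.Gamma_pos_of_pos hr
  have h4 := beta_pos (α := a + r) (β := b + k) (by positivity) (by positivity)
  have h5 := beta_pos ha hb
  positivity

/-- The negative binomial series, `∑ Γ(k + r) / (k! Γ(r)) y ^ k = (1 - y) ^ (-r)`. -/
lemma hasSum_negBinomial {r y : ℝ} (hr : 0 < r) (hy0 : 0 < y) (hy1 : y < 1) :
    HasSum (fun k : ℕ => Real.Gamma (k + r) / (Real.Gamma (k + 1) * Real.Gamma r) * y ^ k)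
      (1 / (1 - y) ^ r) := by
  have h := (Real.one_div_one_sub_rpow_hasFPowerSeriesOnBall_zero r).hasSum (y := y)
    (by rw [mem_eball_zero_iff, Real.enorm_eq_ofReal hy0.le]; simpa using hy1)
  simp only [zero_add, FormalMultilinearSeries.ofScalars_apply_eq] at h
  refine h.congr_fun fun k => ?_
  have hm := Ring.factorial_nsmul_multichoose_eq_ascPochhammer r k
  rw [Ring.multichoose_eq, Polynomial.ascPochhammer_smeval_eq_eval, nsmul_eq_mul] at hm
  have hk : (k.factorial : ℝ) ≠ 0 := by positivity
  have hG := (Real.Gamma_pos_of_pos hr).ne'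
  have hasc : ∀ k : ℕ, Real.Gamma (k + r) = (ascPochhammer ℝ k).eval r * Real.Gamma r := by
    intro k
    induction k with
    | zero => simp
    | succ k ih =>
      rw [ascPochhammer_succ_eval, show ((k + 1 : ℕ) : ℝ) + r = (k + r) + 1 by push_cast; ring,
        Real.Gamma_add_one (by positivity), ih]
      ring
  rw [hasc, Real.Gamma_nat_eq_factorial, smul_eq_mul, eq_div_of_mul_eq hk ((mul_comm _ _).trans hm)]
  field_simp

lemma lintegral_rpow_mul_betaPDF {r a b : ℝ} (hr : 0 < r) (ha : 0 < a) (hb : 0 < b) (k : ℕ) :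
    ∫⁻ x : ℝ, ENNReal.ofReal (x ^ r * (1 - x) ^ k) * betaPDF a b x =
      ENNReal.ofReal (beta (a + r) (b + k) / beta a b) := by
  have hB := beta_pos ha hb
  have hB' := beta_pos (α := a + r) (β := b + k) (by positivity) (by positivity)
  have key : ∀ x : ℝ, ENNReal.ofReal (x ^ r * (1 - x) ^ k) * betaPDF a b x =
      ENNReal.ofReal (beta (a + r) (b + k) / beta a b) * betaPDF (a + r) (b + k) x := by
    intro x
    by_cases hx : 0 < x ∧ x < 1
    · have h1 : 0 < 1 - x := by linarith [hx.2]
      have h0 := hx.1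
      rw [betaPDF_of_pos_lt_one hx.1 hx.2, betaPDF_of_pos_lt_one hx.1 hx.2,
        ← ENNReal.ofReal_mul (by positivity), ← ENNReal.ofReal_mul (by positivity)]
      congr 1
      rw [show a + r - 1 = r + (a - 1) by ring, show b + k - 1 = (b - 1) + k by ring,
        Real.rpow_add h0, Real.rpow_add h1, Real.rpow_natCast]
      field_simp
    · simp [betaPDF_eq, hx]
  simp_rw [key]
  rw [lintegral_const_mul' _ _ (by simp), lintegral_betaPDF_eq_one (by positivity) (by positivity),
    mul_one]

/-- The weights sum to one because they are a beta mixture of negative binomial distributions. -/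
lemma hasSum_weight {r a b : ℝ} (hr : 0 < r) (ha : 0 < a) (hb : 0 < b) :
    HasSum (weight r a b) 1 := by
  have h : ∑' k, ENNReal.ofReal (weight r a b k) = 1 := by
    have hc : ∀ k : ℕ, 0 ≤ Real.Gamma (k + r) / (Real.Gamma (k + 1) * Real.Gamma r) := by
      intro k
      have h1 := Real.Gamma_pos_of_pos (s := k + r) (by positivity)
      have h2 := Real.Gamma_pos_of_pos (s := k + 1) (by positivity)
      have h3 := Real.Gamma_pos_of_pos hr
      positivity
    calc ∑' k, ENNReal.ofReal (weight r a b k)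
        = ∑' k : ℕ, ∫⁻ x : ℝ, ENNReal.ofReal (Real.Gamma (k + r) /
            (Real.Gamma (k + 1) * Real.Gamma r)) *
            (ENNReal.ofReal (x ^ r * (1 - x) ^ k) * betaPDF a b x) := by
          congr 1 with k
          rw [lintegral_const_mul' _ _ (by simp), lintegral_rpow_mul_betaPDF hr ha hb,
            ← ENNReal.ofReal_mul (hc k), weight]
      _ = ∫⁻ x : ℝ, ∑' k : ℕ, ENNReal.ofReal (Real.Gamma (k + r) /
            (Real.Gamma (k + 1) * Real.Gamma r)) *
            (ENNReal.ofReal (x ^ r * (1 - x) ^ k) * betaPDF a b x) := by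
          rw [lintegral_tsum]
          intro k
          have : Measurable (betaPDF a b) := (measurable_betaPDFReal a b).ennreal_ofReal
          fun_prop
      _ = ∫⁻ x : ℝ, betaPDF a b x := by
          congr 1 with x
          by_cases hx : 0 < x ∧ x < 1
          · have h1 : 0 < 1 - x := by linarith [hx.2]
            have h0 := hx.1
            simp_rw [← mul_assoc]
            rw [ENNReal.tsum_mul_right]
            have hs := hasSum_negBinomial hr h1 (by linarith : 1 - x < 1)
            have hs' := hs.mul_left (x ^ r)
            rw [show 1 - (1 - x) = x by ring, mul_one_div_cancel (by positivity)] at hs'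
            have : ∑' k : ℕ, ENNReal.ofReal (Real.Gamma (k + r) /
                (Real.Gamma (k + 1) * Real.Gamma r)) * ENNReal.ofReal (x ^ r * (1 - x) ^ k) = 1 := by
              rw [← ENNReal.ofReal_one]
              refine Eq.trans ?_ (congrArg ENNReal.ofReal hs'.tsum_eq)
              rw [ENNReal.ofReal_tsum_of_nonneg ?_ hs'.summable]
              · congr 1 with k
                rw [← ENNReal.ofReal_mul (hc k)]
                congr 1
                ring
              · intro k
                have := hc k
                positivity
            rw [this, one_mul]
          · simp [betaPDF_eq, hx]
      _ = 1 := lintegral_betaPDF_eq_one ha hb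
  have h2 := ENNReal.hasSum_toReal (f := fun k => ENNReal.ofReal (weight r a b k)) (by simp [h])
  rw [← ENNReal.tsum_toReal_eq (by simp), h] at h2
  simpa [ENNReal.toReal_ofReal (weight_pos hr ha hb _).le] using h2

/-- Size biasing shifts the parameters, which reduces the mean to a total mass. -/
lemma succ_mul_weight {r a b : ℝ} (hr : 0 < r) (ha : 1 < a) (hb : 0 < b) (k : ℕ) :
    ((k + 1 : ℕ) : ℝ) * weight r a b (k + 1) =
      r * b / (a - 1) * weight (r + 1) (a - 1) (b + 1) k := by
  have ha' : 0 < a - 1 := by linarith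
  have e1 : Real.Gamma (((k + 1 : ℕ) : ℝ) + 1) = (k + 1) * Real.Gamma (k + 1) := by
    rw [Real.Gamma_add_one (by positivity)]; push_cast; ring
  have e2 : Real.Gamma (r + 1) = r * Real.Gamma r := Real.Gamma_add_one hr.ne'
  have e3 : Real.Gamma (b + 1) = b * Real.Gamma b := Real.Gamma_add_one hb.ne'
  have e4 : Real.Gamma a = (a - 1) * Real.Gamma (a - 1) := by
    rw [← Real.Gamma_add_one ha'.ne']; ring_nf
  have h1 := Real.Gamma_pos_of_pos (s := k + 1) (by positivity)
  have h2 := Real.Gamma_pos_of_pos hr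
  have h3 := Real.Gamma_pos_of_pos hb
  have h4 := Real.Gamma_pos_of_pos ha'
  have h5 := Real.Gamma_pos_of_pos (s := a + b) (by linarith)
  unfold weight
  rw [show ((k + 1 : ℕ) : ℝ) + r = k + (r + 1) by push_cast; ring,
    show a - 1 + (r + 1) = a + r by ring, show b + ((k + 1 : ℕ) : ℝ) = b + 1 + k by push_cast; ring]
  unfold beta
  rw [show a - 1 + (b + 1) = a + b by ring, e1, e2, e3, e4]
  push_cast
  field_simp

lemma hasSum_mul_weight {r a b : ℝ} (hr : 0 < r) (ha : 1 < a) (hb : 0 < b) :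
    HasSum (fun k : ℕ => (k : ℝ) * weight r a b k) (r * b / (a - 1)) := by
  have h := (hasSum_weight (r := r + 1) (a := a - 1) (b := b + 1) (by linarith) (by linarith)
    (by linarith)).mul_left (r * b / (a - 1))
  rw [mul_one] at h
  rw [← hasSum_nat_add_iff' 1]
  simp only [succ_mul_weight hr ha hb]
  simpa using h

lemma weight_succ {r a b : ℝ} (hr : 0 < r) (ha : 0 < a) (hb : 0 < b) (k : ℕ) :
    weight r a b (k + 1) = (k + r) / (k + 1) * ((b + k) / (a + r + (b + k))) * weight r a b k := by
  have e1 : Real.Gamma (((k + 1 : ℕ) : ℝ) + 1) = (k + 1) * Real.Gamma (k + 1) := by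
    rw [Real.Gamma_add_one (by positivity)]; push_cast; ring
  have e2 : Real.Gamma (((k + 1 : ℕ) : ℝ) + r) = (k + r) * Real.Gamma (k + r) := by
    rw [← Real.Gamma_add_one (by positivity)]; congr 1; push_cast; ring
  have e3 : Real.Gamma (b + ((k + 1 : ℕ) : ℝ)) = (b + k) * Real.Gamma (b + k) := by
    rw [← Real.Gamma_add_one (by positivity)]; congr 1; push_cast; ring
  have e4 : Real.Gamma (a + r + (b + ((k + 1 : ℕ) : ℝ))) =
      (a + r + (b + k)) * Real.Gamma (a + r + (b + k)) := by
    rw [← Real.Gamma_add_one (by positivity)]; congr 1; push_cast; ring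
  have h1 := Real.Gamma_pos_of_pos (s := a + r + (b + k)) (by positivity)
  have h2 := Real.Gamma_pos_of_pos (s := k + 1) (by positivity)
  have h3 := Real.Gamma_pos_of_pos hr
  have h4 := beta_pos ha hb
  unfold weight
  rw [e1, e2, show beta (a + r) (b + ((k + 1 : ℕ) : ℝ)) =
    (b + k) / (a + r + (b + k)) * beta (a + r) (b + k) by
      unfold beta; rw [e3, e4]; field_simp]
  field_simp

/-- A larger successive ratio (monotone likelihood ratio) implies stochastic dominance. -/
lemma sum_range_le_of_ratio_le {p p' ρ ρ' : ℕ → ℝ} (hp : HasSum p 1) (hp' : HasSum p' 1)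
    (h0 : ∀ k, 0 ≤ p k) (hρ0 : ∀ k, 0 ≤ ρ' k)
    (hρ : ∀ k, p (k + 1) = ρ k * p k) (hρ' : ∀ k, p' (k + 1) = ρ' k * p' k)
    (hle : ∀ k, ρ k ≤ ρ' k) (n : ℕ) :
    ∑ k ∈ Finset.range n, p' k ≤ ∑ k ∈ Finset.range n, p k := by
  have step : ∀ k, p k ≤ p' k → p (k + 1) ≤ p' (k + 1) := fun k hk => by
    rw [hρ, hρ']
    exact mul_le_mul (hle k) hk (h0 k) (hρ0 k)
  have up : ∀ j k, p j ≤ p' j → p (k + j) ≤ p' (k + j) := by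
    intro j k hj
    induction k with
    | zero => simpa using hj
    | succ k ih => rw [show k + 1 + j = (k + j) + 1 by ring]; exact step _ ih
  by_cases hn : p n ≤ p' n
  · -- beyond the crossing point the tails are ordered, and both total masses are one
    have t := (hasSum_nat_add_iff' n).2 hp
    have t' := (hasSum_nat_add_iff' n).2 hp'
    have := hasSum_le (fun k => up n k hn) t t'
    linarith
  · refine Finset.sum_le_sum fun k hk => ?_
    by_contra hc
    push Not at hc
    refine hn ?_
    have := up k (n - k) hc.le
    rwa [Nat.sub_add_cancel (Finset.mem_range.1 hk).le] at this

section Law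

variable {r α : ℝ}

lemma param_pos (hr : 0 < r) (hα : 1 < α) {m : ℝ} (hm : 0 < m) : 0 < (α - 1) * m / r :=
  div_pos (mul_pos (by linarith) hm) hr

lemma pmf_pos (hr : 0 < r) (hα : 1 < α) {m : ℝ} (hm : 0 < m) (k : ℕ) : 0 < pmf m r α k :=
  weight_pos hr (by linarith) (param_pos hr hα hm) k

lemma hasSum_pmf (hr : 0 < r) (hα : 1 < α) {m : ℝ} (hm : 0 < m) : HasSum (pmf m r α) 1 :=
  hasSum_weight hr (by linarith) (param_pos hr hα hm)

lemma hasSum_mul_pmf (hr : 0 < r) (hα : 1 < α) {m : ℝ} (hm : 0 < m) :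
    HasSum (fun k : ℕ => (k : ℝ) * pmf m r α k) m := by
  have h := hasSum_mul_weight hr hα (param_pos hr hα hm)
  have hα' : α - 1 ≠ 0 := by linarith
  rwa [show r * ((α - 1) * m / r) / (α - 1) = m by field_simp] at h

lemma cdf_antitone (hr : 0 < r) (hα : 1 < α) {m m' : ℝ} (hm : 0 < m) (hmm : m ≤ m') (n : ℕ) :
    cdf m' r α n ≤ cdf m r α n := by
  have hm' : 0 < m' := hm.trans_le hmm
  have hb := param_pos hr hα hm
  have hb' := param_pos hr hα hm'
  have hα0 : 0 < α := by linarith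
  refine sum_range_le_of_ratio_le (hasSum_pmf hr hα hm) (hasSum_pmf hr hα hm')
    (fun k => (pmf_pos hr hα hm k).le) ?_ (fun k => weight_succ hr hα0 hb k)
    (fun k => weight_succ hr hα0 hb' k) ?_ _
  · intro k; positivity
  · intro k
    have hbb : (α - 1) * m / r ≤ (α - 1) * m' / r := by
      have : 0 ≤ α - 1 := by linarith
      gcongr
    refine mul_le_mul_of_nonneg_left ?_ (by positivity)
    rw [div_le_div_iff₀ (by positivity) (by positivity)]
    have hk : (0 : ℝ) ≤ k := k.cast_nonneg
    nlinarith

lemma cdf_mono_right (hr : 0 < r) (hα : 1 < α) {m : ℝ} (hm : 0 < m) : Monotone (cdf m r α) := by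
  intro n n' h
  exact Finset.sum_le_sum_of_subset_of_nonneg
    (Finset.range_mono (by omega)) fun k _ _ => (pmf_pos hr hα hm k).le

lemma cdf_le_one (hr : 0 < r) (hα : 1 < α) {m : ℝ} (hm : 0 < m) (n : ℕ) : cdf m r α n ≤ 1 :=
  sum_le_hasSum _ (fun k _ => (pmf_pos hr hα hm k).le) (hasSum_pmf hr hα hm)

lemma cdf_pos (hr : 0 < r) (hα : 1 < α) {m : ℝ} (hm : 0 < m) (n : ℕ) : 0 < cdf m r α n :=
  Finset.sum_pos (fun k _ => pmf_pos hr hα hm k) (by simp)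

lemma exists_le_cdf (hr : 0 < r) (hα : 1 < α) {m v : ℝ} (hm : 0 < m) (hv : v < 1) :
    ∃ n, v ≤ cdf m r α n := by
  have h := ((hasSum_pmf hr hα hm).tendsto_sum_nat.comp (Filter.tendsto_add_atTop_nat 1))
  obtain ⟨n, hn⟩ := (h.eventually (lt_mem_nhds hv)).exists
  exact ⟨n, hn.le⟩

lemma quantile_le_iff (hr : 0 < r) (hα : 1 < α) {m v : ℝ} (hm : 0 < m) (hv : v < 1) (n : ℕ) :
    quantile m r α v ≤ n ↔ v ≤ cdf m r α n := by
  refine ⟨fun h => ?_, fun h => Nat.sInf_le h⟩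
  have hmem : v ≤ cdf m r α (quantile m r α v) := Nat.sInf_mem (exists_le_cdf hr hα hm hv)
  exact hmem.trans (cdf_mono_right hr hα hm h)

lemma quantile_mono (hr : 0 < r) (hα : 1 < α) {m m' v : ℝ} (hm : 0 < m) (hmm : m ≤ m')
    (hv : v < 1) : quantile m r α v ≤ quantile m' r α v := by
  rw [quantile_le_iff hr hα hm hv]
  exact ((quantile_le_iff hr hα (hm.trans_le hmm) hv _).1 le_rfl).trans
    (cdf_antitone hr hα hm hmm _)

end Law

/-! ### The quantile coupling -/

/-- The uniform distribution on `(0, 1)`. -/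
noncomputable def unif : Measure ℝ := volume.restrict (Set.Ioo 0 1)

instance : IsProbabilityMeasure unif := ⟨by simp [unif]⟩

lemma ae_unif_mem : ∀ᵐ v ∂unif, v ∈ Set.Ioo (0 : ℝ) 1 := ae_restrict_mem measurableSet_Ioo

section Quantile

variable {r α : ℝ}

lemma continuous_pmf (hr : 0 < r) (hα : 1 < α) (k : ℕ) :
    Continuous fun m : PosReal => pmf m r α k := by
  have hG : ∀ {f : PosReal → ℝ}, Continuous f → (∀ m, 0 < f m) →
      Continuous fun m => Real.Gamma (f m) := fun {f} hf h0 =>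
    continuous_iff_continuousAt.2 fun m =>
      ((Real.differentiableAt_Gamma fun n => by
        have := h0 m; have := n.cast_nonneg (α := ℝ); linarith).continuousAt).comp hf.continuousAt
  have hb : Continuous fun m : PosReal => (α - 1) * (m : ℝ) / r := by fun_prop
  have hb0 := fun m : PosReal => param_pos hr hα m.2
  have hα0 : 0 < α := by linarith
  have h1 : Continuous fun m : PosReal => Real.Gamma ((α - 1) * (m : ℝ) / r) := hG hb hb0
  have h2 : Continuous fun m : PosReal => Real.Gamma (α + (α - 1) * (m : ℝ) / r) :=
    hG (by fun_prop) fun m => by have := hb0 m; positivity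
  have h3 : Continuous fun m : PosReal => Real.Gamma ((α - 1) * (m : ℝ) / r + k) :=
    hG (by fun_prop) fun m => by have := hb0 m; positivity
  have h4 : Continuous fun m : PosReal => Real.Gamma (α + r + ((α - 1) * (m : ℝ) / r + k)) :=
    hG (by fun_prop) fun m => by have := hb0 m; positivity
  have p1 := fun m => (Real.Gamma_pos_of_pos (hb0 m)).ne'
  have p2 : ∀ m : PosReal, Real.Gamma (α + (α - 1) * (m : ℝ) / r) ≠ 0 := fun m =>
    (Real.Gamma_pos_of_pos (by have := hb0 m; positivity)).ne'
  have p4 : ∀ m : PosReal, Real.Gamma (α + r + ((α - 1) * (m : ℝ) / r + k)) ≠ 0 := fun m =>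
    (Real.Gamma_pos_of_pos (by have := hb0 m; positivity)).ne'
  unfold pmf
  refine continuous_const.mul (Continuous.div ?_ ?_ fun m => (beta_pos hα0 (hb0 m)).ne')
  · exact (continuous_const.mul h3).div h4 p4
  · exact (continuous_const.mul h1).div h2 p2

lemma measurable_cdf (hr : 0 < r) (hα : 1 < α) (n : ℕ) :
    Measurable fun m : PosReal => cdf m r α n :=
  Finset.measurable_fun_sum _ fun k _ => (continuous_pmf hr hα k).measurable

lemma measurable_quantile (hr : 0 < r) (hα : 1 < α) :
    Measurable fun p : PosReal × ℝ => quantile p.1 r α p.2 := by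
  have hset : ∀ n, MeasurableSet {p : PosReal × ℝ | p.2 ≤ cdf p.1 r α n} := fun n =>
    measurableSet_le measurable_snd ((measurable_cdf hr hα n).comp measurable_fst)
  refine measurable_of_Iic fun n => ?_
  -- the intersection accounts for `sInf ∅ = 0`
  have : (fun p : PosReal × ℝ => quantile p.1 r α p.2) ⁻¹' Set.Iic n =
      (⋃ k ∈ Set.Iic n, {p : PosReal × ℝ | p.2 ≤ cdf p.1 r α k}) ∪
        (⋂ k, {p : PosReal × ℝ | p.2 ≤ cdf p.1 r α k}ᶜ) := by
    ext p
    simp only [Set.mem_preimage, Set.mem_Iic, Set.mem_union, Set.mem_iUnion, Set.mem_ofPred_eq,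
      Set.mem_iInter, Set.mem_compl_iff, exists_prop]
    constructor
    · intro h
      by_cases hne : ∃ k, p.2 ≤ cdf p.1 r α k
      · exact Or.inl ⟨_, h, Nat.sInf_mem hne⟩
      · exact Or.inr (not_exists.1 hne)
    · rintro (⟨k, hk, h⟩ | h)
      · exact (Nat.sInf_le h).trans hk
      · have : {n | p.2 ≤ cdf p.1 r α n} = ∅ := Set.eq_empty_of_forall_notMem h
        simp [quantile, this]
  rw [this]
  exact (MeasurableSet.biUnion (Set.to_countable _) fun k _ => hset k).union
    (MeasurableSet.iInter fun k => (hset k).compl)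

lemma measurable_quantile_right (hr : 0 < r) (hα : 1 < α) (m : PosReal) :
    Measurable (quantile m r α) :=
  (measurable_quantile hr hα).comp (measurable_const.prodMk measurable_id)

/-- The beta negative binomial distributions as a Markov kernel, realized by quantiles. -/
noncomputable def bnbKernel (hr : 0 < r) (hα : 1 < α) : Kernel PosReal ℕ where
  toFun m := unif.map (quantile m r α)
  measurable' := by
    refine Measure.measurable_of_measurable_coe _ fun s hs => ?_
    simp_rw [Measure.map_apply (measurable_quantile_right hr hα _) hs]
    exact measurable_measure_prodMk_left (measurable_quantile hr hα hs)

lemma bnbKernel_apply (hr : 0 < r) (hα : 1 < α) (m : PosReal) :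
    bnbKernel hr hα m = unif.map (quantile m r α) := rfl

instance (hr : 0 < r) (hα : 1 < α) : IsMarkovKernel (bnbKernel hr hα) :=
  ⟨fun m => Measure.isProbabilityMeasure_map (measurable_quantile_right hr hα m).aemeasurable⟩

lemma bnbKernel_Iic (hr : 0 < r) (hα : 1 < α) (m : PosReal) (n : ℕ) :
    bnbKernel hr hα m (Set.Iic n) = ENNReal.ofReal (cdf m r α n) := by
  rw [bnbKernel_apply, Measure.map_apply (measurable_quantile_right hr hα m) measurableSet_Iic]
  have h : (quantile m r α ⁻¹' Set.Iic n : Set ℝ) =ᵐ[unif] Set.Iic (cdf m r α n) := by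
    filter_upwards [ae_unif_mem] with v hv
    exact propext (quantile_le_iff hr hα m.2 hv.2 n)
  have h1 := cdf_pos hr hα m.2 n
  have h2 := cdf_le_one hr hα m.2 n
  rw [measure_congr h, unif, Measure.restrict_congr_set Ioo_ae_eq_Ioc,
    Measure.restrict_apply measurableSet_Iic, Set.inter_comm, Set.Ioc_inter_Iic, min_eq_right h2,
    Real.volume_Ioc, sub_zero]

lemma bnbKernel_singleton (hr : 0 < r) (hα : 1 < α) (m : PosReal) (k : ℕ) :
    bnbKernel hr hα m {k} = ENNReal.ofReal (pmf m r α k) := by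
  cases k with
  | zero =>
    have : ({0} : Set ℕ) = Set.Iic 0 := by ext; simp
    rw [this, bnbKernel_Iic]
    simp [cdf]
  | succ k =>
    have : ({k + 1} : Set ℕ) = Set.Iic (k + 1) \ Set.Iic k := by ext; simp; omega
    rw [this, measure_sdiff (Set.Iic_subset_Iic.2 k.le_succ) measurableSet_Iic.nullMeasurableSet
      (measure_ne_top _ _), bnbKernel_Iic, bnbKernel_Iic,
      ← ENNReal.ofReal_sub _ (cdf_pos hr hα m.2 k).le]
    congr 1
    rw [cdf, Finset.sum_range_succ, cdf]
    ring

lemma lintegral_bnbKernel (hr : 0 < r) (hα : 1 < α) (m : PosReal) :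
    ∫⁻ k, ENNReal.ofReal (k : ℝ) ∂(bnbKernel hr hα m) = ENNReal.ofReal m := by
  rw [lintegral_countable']
  simp_rw [bnbKernel_singleton]
  have h := hasSum_mul_pmf hr hα m.2
  refine Eq.trans ?_ (congrArg ENNReal.ofReal h.tsum_eq)
  rw [ENNReal.ofReal_tsum_of_nonneg ?_ h.summable]
  · congr 1 with k
    rw [ENNReal.ofReal_mul k.cast_nonneg]
  · exact fun k => mul_nonneg k.cast_nonneg (pmf_pos hr hα m.2 k).le

lemma lintegral_quantile (hr : 0 < r) (hα : 1 < α) (m : PosReal) :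
    ∫⁻ v, ENNReal.ofReal (quantile m r α v : ℝ) ∂unif = ENNReal.ofReal m := by
  rw [← lintegral_bnbKernel hr hα m, bnbKernel_apply,
    lintegral_map (by fun_prop) (measurable_quantile_right hr hα m)]

/-- The quantile coupling of two beta negative binomial distributions is optimal: by stochastic
monotonicity in the mean, the expected distance is the difference of the means. -/
lemma lintegral_quantile_sub (hr : 0 < r) (hα : 1 < α) (m m' : PosReal) :
    ∫⁻ v, ENNReal.ofReal |(quantile m r α v : ℝ) - quantile m' r α v| ∂unif =
      ENNReal.ofReal |(m : ℝ) - m'| := by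
  wlog h : m' ≤ m generalizing m m'
  · simpa only [abs_sub_comm] using this m' m (le_of_not_ge h)
  have h' : (m' : ℝ) ≤ m := h
  have hae : ∀ᵐ v ∂unif, ENNReal.ofReal |(quantile m r α v : ℝ) - quantile m' r α v| =
      ENNReal.ofReal (quantile m r α v : ℝ) - ENNReal.ofReal (quantile m' r α v : ℝ) := by
    filter_upwards [ae_unif_mem] with v hv
    have hq : (quantile m' r α v : ℝ) ≤ quantile m r α v := by
      exact_mod_cast quantile_mono hr hα m'.2 h hv.2
    rw [abs_of_nonneg (by linarith), ENNReal.ofReal_sub _ (by positivity)]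
  rw [lintegral_congr_ae hae, lintegral_sub ?_ ?_ ?_, lintegral_quantile hr hα, lintegral_quantile hr hα,
    abs_of_nonneg (by linarith), ENNReal.ofReal_sub _ m'.2.le]
  · have := measurable_quantile_right hr hα m'
    exact ((measurable_from_top (f := fun k : ℕ => ENNReal.ofReal (k : ℝ))).comp this)
  · rw [lintegral_quantile hr hα]; simp
  · filter_upwards [ae_unif_mem] with v hv
    exact ENNReal.ofReal_le_ofReal (by exact_mod_cast quantile_mono hr hα m'.2 h hv.2)

end Quantile

/-! ### Independent sequences -/

section Sequences

variable {S : Type*} [MeasurableSpace S]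

/-- The one-sided sequence without its first term. -/
def tail (x : ℕ → S) : ℕ → S := fun n => x (n + 1)

@[fun_prop]
lemma measurable_tail : Measurable (tail : (ℕ → S) → ℕ → S) :=
  measurable_pi_lambda _ fun _ => measurable_pi_apply _

/-- The law of an i.i.d. sequence is the product of the laws of its head and of its tail. -/
lemma measurePreserving_head_tail (μ : Measure S) [IsProbabilityMeasure μ] :
    MeasurePreserving (fun x : ℕ → S => (x 0, tail x)) (Measure.infinitePi fun _ : ℕ => μ)
      (μ.prod (Measure.infinitePi fun _ : ℕ => μ)) := by
  have hm : Measurable (fun x : ℕ → S => (x 0, tail x)) := by fun_prop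
  let cons : S × (ℕ → S) → ℕ → S := fun p n => Nat.casesOn n p.1 p.2
  have hc : Measurable cons := by
    refine measurable_pi_lambda _ fun n => ?_
    cases n with
    | zero => exact measurable_fst
    | succ n => exact (measurable_pi_apply n).comp measurable_snd
  have key : (μ.prod (Measure.infinitePi fun _ : ℕ => μ)).map cons =
      Measure.infinitePi fun _ : ℕ => μ := by
    refine Measure.eq_infinitePi _ fun s t ht => ?_
    classical
    -- constrain the coordinates outside `s` trivially to make the index set an initial segment
    let t' : ℕ → Set S := fun i => if i ∈ s then t i else Set.univ
    have ht' : ∀ i, MeasurableSet (t' i) := fun i => by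
      by_cases h : i ∈ s <;> simp [t', h, ht i]
    obtain ⟨N, hN⟩ := s.exists_nat_subset_range
    have hN' : s ⊆ Finset.range (N + 1) := hN.trans (Finset.range_mono N.le_succ)
    have e1 : Set.pi s t = Set.pi (Finset.range (N + 1)) t' := by
      ext x
      simp only [Set.mem_pi, Finset.mem_coe, t']
      constructor
      · intro h i _
        by_cases hi : i ∈ s
        · simpa [hi] using h i hi
        · simp [hi]
      · intro h i hi
        simpa [hi] using h i (hN' hi)
    have e2 : ∏ i ∈ s, μ (t i) = ∏ i ∈ Finset.range (N + 1), μ (t' i) := by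
      rw [← Finset.prod_subset hN' (f := fun i => μ (t' i))]
      · exact Finset.prod_congr rfl fun i hi => by simp [t', hi]
      · intro i _ hi
        simp [t', hi]
    rw [e1, e2, Measure.map_apply hc (MeasurableSet.pi (Finset.countable_toSet _) fun i _ => ht' i)]
    have e3 : cons ⁻¹' Set.pi (Finset.range (N + 1)) t' =
        t' 0 ×ˢ Set.pi (Finset.range N) fun i => t' (i + 1) := by
      ext p
      simp only [Set.mem_preimage, Set.mem_pi, Finset.coe_range, Set.mem_Iio, Set.mem_prod, cons]
      constructor
      · exact fun h => ⟨h 0 (by omega), fun i hi => h (i + 1) (by omega)⟩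
      · rintro ⟨h0, h1⟩ (_ | i) hi
        · exact h0
        · exact h1 i (by omega)
    rw [e3, Measure.prod_prod, Measure.infinitePi_pi _ fun i _ => ht' _, Finset.prod_range_succ',
      mul_comm]
  refine ⟨hm, ?_⟩
  conv_lhs => rw [← key]
  rw [Measure.map_map hm hc]
  exact Measure.map_id

end Sequences

/-! ### The conditional mean as a function of the past innovations -/

/-- The Lipschitz condition `|g k x - g k' x'| ≤ c₁ |k - k'| + c₂ |x - x'|`. -/
def LipschitzPair (g : ℕ → PosReal → PosReal) (c₁ c₂ : ℝ) : Prop :=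
  ∀ (k k' : ℕ) (x x' : PosReal),
    |(g k x : ℝ) - (g k' x' : ℝ)| ≤ c₁ * |(k : ℝ) - (k' : ℝ)| + c₂ * |(x : ℝ) - (x' : ℝ)|

/-- The law of a one-sided sequence of i.i.d. uniform innovations. -/
noncomputable abbrev innov : Measure (ℕ → ℝ) := Measure.infinitePi fun _ : ℕ => unif

/-- The identity on `(0, ∞)`, extended by the value `1`. -/
noncomputable def toPos (x : ℝ) : PosReal := if h : 0 < x then ⟨x, h⟩ else ⟨1, one_pos⟩

lemma toPos_of_pos {x : ℝ} (h : 0 < x) : toPos x = ⟨x, h⟩ := dif_pos h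

lemma coe_toPos {x : ℝ} (h : 0 < x) : (toPos x : ℝ) = x := by rw [toPos_of_pos h]

lemma toPos_coe (x : PosReal) : toPos x = x := toPos_of_pos x.2

lemma measurable_toPos : Measurable toPos := by
  have h : (toPos : ℝ → PosReal) = fun x => ⟨if 0 < x then x else 1, by
      split_ifs with h; exacts [h, one_pos]⟩ := by
    ext x
    by_cases h : 0 < x <;> simp [toPos, h]
  rw [h]
  exact (Measurable.ite measurableSet_Ioi measurable_id measurable_const).subtype_mk

section Recursion

variable {r α : ℝ} {g : ℕ → PosReal → PosReal} {c₁ c₂ : ℝ}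

lemma LipschitzPair.continuous (hg : LipschitzPair g c₁ c₂) (k : ℕ) : Continuous (g k) := by
  refine continuous_iff_continuousAt.2 fun x => tendsto_iff_dist_tendsto_zero.2 ?_
  have h0 : Filter.Tendsto (fun y : PosReal => c₂ * |(y : ℝ) - x|) (nhds x) (nhds 0) := by
    have : Continuous fun y : PosReal => c₂ * |(y : ℝ) - x| := by fun_prop
    simpa using this.tendsto x
  refine squeeze_zero (fun _ => dist_nonneg) (fun y => ?_) h0
  rw [Subtype.dist_eq, Real.dist_eq]
  simpa using hg k k y x

lemma LipschitzPair.measurable (hg : LipschitzPair g c₁ c₂) :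
    Measurable fun p : ℕ × PosReal => g p.1 p.2 :=
  measurable_from_prod_countable_right fun k => (hg.continuous k).measurable

/-- `e` is the value of `g 0` at `0`, by continuity. -/
lemma LipschitzPair.exists_limit (hg : LipschitzPair g c₁ c₂) (hc₂ : 0 < c₂)
    (hg0 : ∃ ε : ℝ, 0 < ε ∧ ∃ δ : ℝ, 0 < δ ∧ ∀ x : PosReal, (x : ℝ) < δ → ε ≤ (g 0 x : ℝ)) :
    ∃ e : ℝ, 0 < e ∧ ∀ (k : ℕ) (x : PosReal), |(g k x : ℝ) - e| ≤ c₁ * k + c₂ * x := by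
  obtain ⟨ε, hε, δ, hδ, hgε⟩ := hg0
  let s : ℕ → PosReal := fun n => ⟨1 / ((n : ℝ) + 1), by positivity⟩
  have hs : Filter.Tendsto (fun n => (s n : ℝ)) Filter.atTop (nhds 0) :=
    tendsto_one_div_add_atTop_nhds_zero_nat
  have hcauchy : CauchySeq fun n => (g 0 (s n) : ℝ) := by
    refine cauchySeq_of_le_tendsto_0' (fun n => c₂ * s n) (fun n m hnm => ?_)
      (by simpa using hs.const_mul c₂)
    rw [Real.dist_eq]
    refine (hg 0 0 (s n) (s m)).trans ?_
    have h1 : (s m : ℝ) ≤ s n := one_div_le_one_div_of_le (by positivity) (by gcongr)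
    have h2 : (0 : ℝ) < s m := (s m).2
    rw [abs_of_nonneg (by linarith : (0 : ℝ) ≤ (s n : ℝ) - s m)]
    simp only [sub_self, abs_zero, mul_zero, zero_add]
    gcongr
    linarith
  obtain ⟨e, he⟩ := cauchySeq_tendsto_of_complete hcauchy
  refine ⟨e, hε.trans_le (ge_of_tendsto he ?_), fun k x => ?_⟩
  · filter_upwards [hs.eventually (gt_mem_nhds hδ)] with n hn using hgε _ hn
  · have h1 := ((tendsto_const_nhds (x := (g k x : ℝ))).sub he).abs
    have h2 : Filter.Tendsto (fun n => c₁ * |(k : ℝ) - (0 : ℕ)| + c₂ * |(x : ℝ) - s n|)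
        Filter.atTop (nhds (c₁ * |(k : ℝ) - (0 : ℕ)| + c₂ * |(x : ℝ) - 0|)) :=
      ((hs.const_sub (x : ℝ)).abs.const_mul c₂).const_add _
    refine (le_of_tendsto_of_tendsto' h1 h2 fun n => hg k 0 x (s n)).trans_eq ?_
    simp [abs_of_pos x.2]

/-- The one-step contraction: two copies of the conditional mean process that share their
innovation approach each other in mean at the rate `c₁ + c₂`. -/
lemma LipschitzPair.lintegral_le (hr : 0 < r) (hα : 1 < α) (hg : LipschitzPair g c₁ c₂)
    (hc₁ : 0 < c₁) (hc₂ : 0 < c₂) (x x' : PosReal) :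
    ∫⁻ v, ENNReal.ofReal |(g (quantile x r α v) x : ℝ) - g (quantile x' r α v) x'| ∂unif ≤
      ENNReal.ofReal ((c₁ + c₂) * |(x : ℝ) - x'|) := by
  calc _ ≤ ∫⁻ v, (ENNReal.ofReal c₁ *
          ENNReal.ofReal |(quantile x r α v : ℝ) - quantile x' r α v| +
          ENNReal.ofReal (c₂ * |(x : ℝ) - x'|)) ∂unif := by
        refine lintegral_mono fun v => ?_
        rw [← ENNReal.ofReal_mul hc₁.le, ← ENNReal.ofReal_add (by positivity) (by positivity)]
        exact ENNReal.ofReal_le_ofReal (hg _ _ _ _)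
    _ = _ := by
        rw [lintegral_add_right _ measurable_const, lintegral_const_mul' _ _ (by simp),
          lintegral_quantile_sub hr hα, lintegral_const, measure_univ, mul_one,
          ← ENNReal.ofReal_mul hc₁.le, ← ENNReal.ofReal_add (by positivity) (by positivity)]
        congr 1
        ring

/-- One step of the recursion for the conditional mean, extended to nonpositive arguments by the
constant `e`. -/
noncomputable def step (r α : ℝ) (g : ℕ → PosReal → PosReal) (e x v : ℝ) : ℝ :=
  if 0 < x then g (quantile (toPos x) r α v) (toPos x) else e

lemma step_coe (e : ℝ) (x : PosReal) (v : ℝ) :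
    step r α g e x v = g (quantile x r α v) x := by
  rw [step, if_pos x.2, toPos_coe]

lemma step_of_nonpos (e : ℝ) {x : ℝ} (hx : x ≤ 0) (v : ℝ) : step r α g e x v = e :=
  if_neg hx.not_gt

lemma step_pos {e : ℝ} (he : 0 < e) (x v : ℝ) : 0 < step r α g e x v := by
  unfold step
  split_ifs
  exacts [Subtype.prop _, he]

lemma measurable_step (hr : 0 < r) (hα : 1 < α) (hg : LipschitzPair g c₁ c₂) (e : ℝ) :
    Measurable fun p : ℝ × ℝ => step r α g e p.1 p.2 := by
  have h1 : Measurable fun p : ℝ × ℝ => toPos p.1 := measurable_toPos.comp measurable_fst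
  refine Measurable.ite (measurableSet_lt measurable_const measurable_fst) ?_ measurable_const
  exact (hg.measurable.comp
    (((measurable_quantile hr hα).comp (h1.prodMk measurable_snd)).prodMk h1)).subtype_val

/-- The one-step contraction for the extended recursion. At a nonpositive argument the extension
behaves as if the observation and the conditional mean were both `0`. -/
lemma lintegral_step_le (hr : 0 < r) (hα : 1 < α) (hg : LipschitzPair g c₁ c₂)
    (hc₁ : 0 < c₁) (hc₂ : 0 < c₂) {e : ℝ}
    (he : ∀ (k : ℕ) (x : PosReal), |(g k x : ℝ) - e| ≤ c₁ * k + c₂ * x) (x x' : ℝ) :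
    ∫⁻ v, ‖step r α g e x v - step r α g e x' v‖ₑ ∂unif ≤
      ENNReal.ofReal (c₁ + c₂) * ‖x - x'‖ₑ := by
  wlog h : x' ≤ x generalizing x x'
  · simpa only [enorm_sub_rev] using this x' x (le_of_not_ge h)
  simp only [Real.enorm_eq_ofReal_abs]
  rw [← ENNReal.ofReal_mul (by positivity)]
  by_cases hx' : 0 < x'
  · lift x to PosReal using hx'.trans_le h
    lift x' to PosReal using hx'
    simpa only [step_coe] using hg.lintegral_le hr hα hc₁ hc₂ x x'
  push Not at hx'
  by_cases hx : 0 < x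
  · lift x to PosReal using hx
    simp only [step_coe, step_of_nonpos e hx']
    calc _ ≤ ∫⁻ v, (ENNReal.ofReal c₁ * ENNReal.ofReal (quantile x r α v : ℝ) +
            ENNReal.ofReal (c₂ * x)) ∂unif := by
          have := x.2
          refine lintegral_mono fun v => ?_
          rw [← ENNReal.ofReal_mul hc₁.le, ← ENNReal.ofReal_add (by positivity) (by positivity)]
          exact ENNReal.ofReal_le_ofReal (he _ _)
      _ = ENNReal.ofReal ((c₁ + c₂) * x) := by
          have := x.2
          rw [lintegral_add_right _ measurable_const, lintegral_const_mul' _ _ (by simp),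
            lintegral_quantile hr hα, lintegral_const, measure_univ, mul_one,
            ← ENNReal.ofReal_mul hc₁.le, ← ENNReal.ofReal_add (by positivity) (by positivity)]
          congr 1
          ring
      _ ≤ _ := by
          refine ENNReal.ofReal_le_ofReal (mul_le_mul_of_nonneg_left ?_ (by positivity))
          rw [abs_of_nonneg (by linarith)]
          linarith
  · push Not at hx
    simp [step_of_nonpos e hx, step_of_nonpos e hx']

lemma lintegral_step_tail_le (hr : 0 < r) (hα : 1 < α) (hg : LipschitzPair g c₁ c₂)
    (hc₁ : 0 < c₁) (hc₂ : 0 < c₂) {e : ℝ}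
    (he : ∀ (k : ℕ) (x : PosReal), |(g k x : ℝ) - e| ≤ c₁ * k + c₂ * x)
    {X X' : (ℕ → ℝ) → ℝ} (hX : Measurable X) (hX' : Measurable X') :
    ∫⁻ w, ‖step r α g e (X (tail w)) (w 0) - step r α g e (X' (tail w)) (w 0)‖ₑ ∂innov ≤
      ENNReal.ofReal (c₁ + c₂) * ∫⁻ w, ‖X w - X' w‖ₑ ∂innov := by
  have hs := measurable_step hr hα hg e
  have hm : Measurable fun p : ℝ × (ℕ → ℝ) =>
      ‖step r α g e (X p.2) p.1 - step r α g e (X' p.2) p.1‖ₑ :=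
    ((hs.comp ((hX.comp measurable_snd).prodMk measurable_fst)).sub
      (hs.comp ((hX'.comp measurable_snd).prodMk measurable_fst))).enorm
  rw [(measurePreserving_head_tail unif).lintegral_comp hm, lintegral_prod_symm _ hm.aemeasurable,
    ← lintegral_const_mul' _ _ (by simp)]
  exact lintegral_mono fun w => lintegral_step_le hr hα hg hc₁ hc₂ he _ _

/-- The conditional mean as a function of the past innovations, found as the Banach fixed point in
`L¹` of the map which sends `X` to one step of the recursion started at `X ∘ tail`. -/
theorem exists_mean_function (hr : 0 < r) (hα : 1 < α) (hg : LipschitzPair g c₁ c₂)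
    (hc₁ : 0 < c₁) (hc₂ : 0 < c₂) (hc : c₁ + c₂ < 1)
    (hg0 : ∃ ε : ℝ, 0 < ε ∧ ∃ δ : ℝ, 0 < δ ∧ ∀ x : PosReal, (x : ℝ) < δ → ε ≤ (g 0 x : ℝ)) :
    ∃ h : (ℕ → ℝ) → PosReal, Measurable h ∧ Integrable (fun w => (h w : ℝ)) innov ∧
      ∀ᵐ w ∂innov, h w = g (quantile (h (tail w)) r α (w 0)) (h (tail w)) := by
  obtain ⟨e, he0, he⟩ := hg.exists_limit hc₂ hg0
  have hs := measurable_step hr hα hg e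
  have hmeas : ∀ {X : (ℕ → ℝ) → ℝ}, Measurable X →
      Measurable fun w : ℕ → ℝ => step r α g e (X (tail w)) (w 0) := fun hX =>
    hs.comp ((hX.comp measurable_tail).prodMk (measurable_pi_apply 0))
  have hXm := fun X : Lp ℝ 1 innov => (Lp.stronglyMeasurable X).measurable
  have hmem : ∀ X : Lp ℝ 1 innov, MemLp (fun w => step r α g e (X (tail w)) (w 0)) 1 innov := by
    intro X
    have h1 : MemLp (fun w => step r α g e (X (tail w)) (w 0) - e) 1 innov := by
      refine memLp_one_iff_integrable.2 ⟨((hmeas (hXm X)).sub_const e).aestronglyMeasurable, ?_⟩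
      have h2 := lintegral_step_tail_le hr hα hg hc₁ hc₂ he (hXm X) (measurable_const (a := (0 : ℝ)))
      simp only [step_of_nonpos e le_rfl, sub_zero] at h2
      refine h2.trans_lt (ENNReal.mul_lt_top (by simp) ?_)
      exact (memLp_one_iff_integrable.1 (Lp.memLp X)).2
    have h3 := h1.add (memLp_const e)
    exact h3.ae_eq (Filter.Eventually.of_forall fun w => by simp)
  let T : Lp ℝ 1 innov → Lp ℝ 1 innov := fun X => (hmem X).toLp _
  have hT : ContractingWith (c₁ + c₂).toNNReal T := by
    refine ⟨by simpa [Real.toNNReal_lt_one] using hc, fun X X' => ?_⟩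
    rw [Lp.edist_toLp_toLp, Lp.edist_def, eLpNorm_one_eq_lintegral_enorm,
      eLpNorm_one_eq_lintegral_enorm]
    exact lintegral_step_tail_le hr hα hg hc₁ hc₂ he (hXm X) (hXm X')
  have hfix := hT.fixedPoint_isFixedPt
  set X := hT.fixedPoint T with hXdef
  have hXae : ∀ᵐ w ∂innov, X w = step r α g e (X (tail w)) (w 0) := by
    have h1 := (hmem X).coeFn_toLp
    have h2 : (hmem X).toLp _ = X := hfix
    rwa [h2] at h1
  have hpos : ∀ᵐ w ∂innov, 0 < X w := by
    filter_upwards [hXae] with w hw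
    rw [hw]
    exact step_pos he0 _ _
  have htail : MeasurePreserving (tail : (ℕ → ℝ) → ℕ → ℝ) innov innov :=
    measurePreserving_snd.comp (measurePreserving_head_tail unif)
  refine ⟨fun w => toPos (X w), measurable_toPos.comp (hXm X), ?_, ?_⟩
  · refine (memLp_one_iff_integrable.1 (Lp.memLp X)).congr ?_
    filter_upwards [hpos] with w hw
    rw [coe_toPos hw]
  · filter_upwards [hXae, hpos, htail.quasiMeasurePreserving.ae hpos] with w hw hw0 hw1
    refine Subtype.ext ?_
    rw [coe_toPos hw0, hw, step, if_pos hw1]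

/-- The bounded, strictly increasing and concave rescaling `d / (1 + d)` of a distance. -/
noncomputable def rescale (d : ℝ) : ℝ := d / (1 + d)

lemma measurable_rescale : Measurable rescale := by unfold rescale; fun_prop

lemma rescale_nonneg {d : ℝ} (hd : 0 ≤ d) : 0 ≤ rescale d := by unfold rescale; positivity

lemma rescale_sub_rescale {b d : ℝ} (hb : 0 ≤ b) (hd : 0 ≤ d) :
    rescale d - rescale b = (d - b) / ((1 + d) * (1 + b)) := by
  unfold rescale
  field_simp
  ring

lemma integrable_rescale {Ω : Type*} [MeasurableSpace Ω] {P : Measure Ω} [IsFiniteMeasure P]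
    {F : Ω → ℝ} (hF : Measurable F) (h0 : ∀ ω, 0 ≤ F ω) :
    Integrable (fun ω => rescale (F ω)) P := by
  refine Integrable.of_bound (measurable_rescale.comp hF).aestronglyMeasurable 1
    (Filter.Eventually.of_forall fun ω => ?_)
  rw [Real.norm_of_nonneg (rescale_nonneg (h0 ω)), rescale]
  have := h0 ω
  exact (div_le_one (by positivity)).2 (by linarith)

/-- Jensen's inequality for the concave function `rescale`, by its tangent line. -/
lemma integral_rescale_le {Ω : Type*} [MeasurableSpace Ω] {P : Measure Ω} [IsProbabilityMeasure P]
    {F : Ω → ℝ} (h0 : ∀ ω, 0 ≤ F ω) (hF : Integrable F P) {a : ℝ} (ha : 0 ≤ a)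
    (hle : ∫ ω, F ω ∂P ≤ a) : ∫ ω, rescale (F ω) ∂P ≤ rescale a := by
  have htan : ∀ z, 0 ≤ z → rescale z ≤ rescale a + (z - a) / (1 + a) ^ 2 := by
    intro z hz
    have h1 : rescale a + (z - a) / (1 + a) ^ 2 - rescale z =
        (z - a) ^ 2 / ((1 + a) ^ 2 * (1 + z)) := by
      unfold rescale; field_simp; ring
    have h2 : 0 ≤ (z - a) ^ 2 / ((1 + a) ^ 2 * (1 + z)) := by positivity
    linarith
  have hi : Integrable (fun ω => (F ω - a) / (1 + a) ^ 2) P :=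
    (hF.sub (integrable_const a)).div_const _
  calc ∫ ω, rescale (F ω) ∂P
      ≤ ∫ ω, (rescale a + (F ω - a) / (1 + a) ^ 2) ∂P :=
        integral_mono_of_nonneg (Filter.Eventually.of_forall fun ω => rescale_nonneg (h0 ω))
          ((integrable_const _).add hi) (Filter.Eventually.of_forall fun ω => htan _ (h0 ω))
    _ = rescale a + (∫ ω, F ω ∂P - a) / (1 + a) ^ 2 := by
        rw [integral_add (integrable_const _) hi, integral_div, integral_sub hF (integrable_const a)]
        simp
    _ ≤ rescale a := by
        have : (∫ ω, F ω ∂P - a) / (1 + a) ^ 2 ≤ 0 :=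
          div_nonpos_of_nonpos_of_nonneg (by linarith) (by positivity)
        linarith

lemma measurable_next (hr : 0 < r) (hα : 1 < α) (hg : LipschitzPair g c₁ c₂) :
    Measurable fun p : PosReal × ℝ => g (quantile p.1 r α p.2) p.1 :=
  hg.measurable.comp ((measurable_quantile hr hα).prodMk measurable_fst)

lemma measurable_next_right (hr : 0 < r) (hα : 1 < α) (hg : LipschitzPair g c₁ c₂)
    (x : PosReal) : Measurable fun v : ℝ => g (quantile x r α v) x :=
  (measurable_next hr hα hg).comp (measurable_const.prodMk measurable_id)

lemma integrable_dist_next (hr : 0 < r) (hα : 1 < α) (hg : LipschitzPair g c₁ c₂)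
    (hc₁ : 0 < c₁) (hc₂ : 0 < c₂) (x x' : PosReal) :
    Integrable (fun v => |(g (quantile x r α v) x : ℝ) - g (quantile x' r α v) x'|) unif := by
  refine ⟨((measurable_next_right hr hα hg x).subtype_val.sub
    (measurable_next_right hr hα hg x').subtype_val).abs.aestronglyMeasurable, ?_⟩
  refine lt_of_le_of_lt (le_of_eq ?_)
    ((hg.lintegral_le hr hα hc₁ hc₂ x x').trans_lt ENNReal.ofReal_lt_top)
  refine lintegral_congr fun v => ?_
  rw [Real.enorm_eq_ofReal_abs, abs_abs]

lemma integral_dist_next_le (hr : 0 < r) (hα : 1 < α) (hg : LipschitzPair g c₁ c₂)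
    (hc₁ : 0 < c₁) (hc₂ : 0 < c₂) (x x' : PosReal) :
    ∫ v, |(g (quantile x r α v) x : ℝ) - g (quantile x' r α v) x'| ∂unif ≤
      (c₁ + c₂) * |(x : ℝ) - x'| := by
  rw [integral_eq_lintegral_of_nonneg_ae (Filter.Eventually.of_forall fun v => abs_nonneg _)
    (integrable_dist_next hr hα hg hc₁ hc₂ x x').aestronglyMeasurable]
  exact ENNReal.toReal_le_of_le_ofReal (by positivity) (hg.lintegral_le hr hα hc₁ hc₂ x x')

/-- The mean function is determined almost everywhere by its recursion. No integrability is needed: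
the contraction is applied to the distance rescaled by the bounded function `rescale`, which
strictly separates `d` from `(c₁ + c₂) d` unless `d = 0`. -/
theorem mean_function_unique (hr : 0 < r) (hα : 1 < α) (hg : LipschitzPair g c₁ c₂)
    (hc₁ : 0 < c₁) (hc₂ : 0 < c₂) (hc : c₁ + c₂ < 1)
    {h h' : (ℕ → ℝ) → PosReal} (hh : Measurable h) (hh' : Measurable h')
    (hrec : ∀ᵐ w ∂innov, h w = g (quantile (h (tail w)) r α (w 0)) (h (tail w)))
    (hrec' : ∀ᵐ w ∂innov, h' w = g (quantile (h' (tail w)) r α (w 0)) (h' (tail w))) :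
    ∀ᵐ w ∂innov, h' w = h w := by
  have hc0 : 0 < c₁ + c₂ := by positivity
  let D : (ℕ → ℝ) → ℝ := fun w => |(h w : ℝ) - h' w|
  have hD0 : ∀ w, 0 ≤ D w := fun w => abs_nonneg _
  have hD : Measurable D := (hh.subtype_val.sub hh'.subtype_val).abs
  have hi1 : Integrable (fun w => rescale (D w)) innov := integrable_rescale hD hD0
  have hcD0 : ∀ w, 0 ≤ (c₁ + c₂) * D w := fun w => mul_nonneg hc0.le (hD0 w)
  have hi2 : Integrable (fun w => rescale ((c₁ + c₂) * D w)) innov :=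
    integrable_rescale (hD.const_mul _) hcD0
  let F : ℝ × (ℕ → ℝ) → ℝ := fun p =>
    |(g (quantile (h p.2) r α p.1) (h p.2) : ℝ) - g (quantile (h' p.2) r α p.1) (h' p.2)|
  have hF : Measurable F := by
    have hq : ∀ {f : (ℕ → ℝ) → PosReal}, Measurable f →
        Measurable fun p : ℝ × (ℕ → ℝ) => g (quantile (f p.2) r α p.1) (f p.2) := fun hf =>
      (measurable_next hr hα hg).comp ((hf.comp measurable_snd).prodMk measurable_fst)
    exact ((hq hh).subtype_val.sub (hq hh').subtype_val).abs
  have hFi : Integrable (fun p => rescale (F p)) (unif.prod innov) :=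
    integrable_rescale hF fun p => abs_nonneg _
  have hstep : ∀ w, ∫ v, rescale (F (v, w)) ∂unif ≤ rescale ((c₁ + c₂) * D w) := fun w =>
    integral_rescale_le (F := fun v => F (v, w)) (fun _ => abs_nonneg _)
      (integrable_dist_next hr hα hg hc₁ hc₂ (h w) (h' w)) (hcD0 w)
      (integral_dist_next_le hr hα hg hc₁ hc₂ (h w) (h' w))
  have hmain : ∫ w, rescale (D w) ∂innov ≤ ∫ w, rescale ((c₁ + c₂) * D w) ∂innov := by
    have hae : (fun w => rescale (D w)) =ᵐ[innov] fun w => rescale (F (w 0, tail w)) := by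
      filter_upwards [hrec, hrec'] with w hw hw'
      simp only [D, F]
      rw [hw, hw']
    have hmp := measurePreserving_head_tail unif
    have hmap : ∫ w, rescale (F (w 0, tail w)) ∂innov =
        ∫ p, rescale (F p) ∂(unif.prod innov) := by
      have hm : Measurable fun p => rescale (F p) := measurable_rescale.comp hF
      rw [← hmp.map_eq]
      exact (integral_map hmp.measurable.aemeasurable hm.aestronglyMeasurable).symm
    rw [integral_congr_ae hae, hmap, integral_prod_symm _ hFi]
    exact integral_mono hFi.integral_prod_right hi2 hstep
  have hdiff : ∀ w, rescale (D w) - rescale ((c₁ + c₂) * D w) =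
      (1 - (c₁ + c₂)) * D w / ((1 + D w) * (1 + (c₁ + c₂) * D w)) := fun w => by
    rw [rescale_sub_rescale (hcD0 w) (hD0 w)]
    ring
  have hnn : ∀ w, 0 ≤ rescale (D w) - rescale ((c₁ + c₂) * D w) := fun w => by
    have h1 := hD0 w
    have h2 : 0 ≤ 1 - (c₁ + c₂) := by linarith
    rw [hdiff]
    positivity
  have hzero : ∫ w, (rescale (D w) - rescale ((c₁ + c₂) * D w)) ∂innov = 0 := by
    refine le_antisymm ?_ (integral_nonneg hnn)
    rw [integral_sub hi1 hi2]
    linarith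
  filter_upwards [(integral_eq_zero_iff_of_nonneg hnn (hi1.sub hi2)).1 hzero] with w hw
  have h1 := hD0 w
  have hw' : (1 - (c₁ + c₂)) * D w / ((1 + D w) * (1 + (c₁ + c₂) * D w)) = 0 := by
    rw [← hdiff]; exact hw
  have hDw : D w = 0 := by
    rcases div_eq_zero_iff.1 hw' with h2 | h2
    · exact (mul_eq_zero.1 h2).resolve_left (by linarith)
    · have : 0 < (1 + D w) * (1 + (c₁ + c₂) * D w) := by positivity
      linarith
  exact Subtype.ext (sub_eq_zero.1 (abs_eq_zero.1 hDw)).symm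

end Recursion

/-! ### The conditional mean as a function of the past observations -/

/-- The conditional mean computed from the last `n` observations `y 0, …, y (n - 1)` (most recent
first), when the recursion is started at the value `1`. -/
noncomputable def truncatedMean (g : ℕ → PosReal → PosReal) : ℕ → (ℕ → ℕ) → PosReal
  | 0, _ => ⟨1, one_pos⟩
  | n + 1, y => g (y 0) (truncatedMean g n (tail y))

instance : Nonempty PosReal := ⟨⟨1, one_pos⟩⟩

/-- The conditional mean computed from the infinite past of the observations. -/
noncomputable def pastMean (g : ℕ → PosReal → PosReal) (y : ℕ → ℕ) : PosReal :=
  Filter.limUnder Filter.atTop fun n => truncatedMean g n y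

/-- The sequence without its first `n` terms. -/
def drop {S : Type*} (n : ℕ) (x : ℕ → S) : ℕ → S := fun i => x (i + n)

/-- The observations as a function of the innovations, most recent first. -/
noncomputable def obs (r α : ℝ) (h : (ℕ → ℝ) → PosReal) (w : ℕ → ℝ) : ℕ → ℕ :=
  fun n => quantile (h (drop (n + 1) w)) r α (w n)

section Past

variable {r α : ℝ} {g : ℕ → PosReal → PosReal} {c₁ c₂ : ℝ} {h : (ℕ → ℝ) → PosReal}

lemma measurable_drop {S : Type*} [MeasurableSpace S] (n : ℕ) :
    Measurable (drop n : (ℕ → S) → ℕ → S) :=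
  measurable_pi_lambda _ fun _ => measurable_pi_apply _

lemma measurable_obs (hr : 0 < r) (hα : 1 < α) (hh : Measurable h) : Measurable (obs r α h) :=
  measurable_pi_lambda _ fun n => (measurable_quantile hr hα).comp
    ((hh.comp (measurable_drop (n + 1))).prodMk (measurable_pi_apply n))

lemma measurable_truncatedMean (hg : LipschitzPair g c₁ c₂) (n : ℕ) :
    Measurable (truncatedMean g n) := by
  induction n with
  | zero => exact measurable_const
  | succ n ih =>
    exact hg.measurable.comp ((measurable_pi_apply 0).prodMk (ih.comp measurable_tail))

instance : PolishSpace PosReal := isOpen_Ioi.polishSpace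

lemma measurable_pastMean (hg : LipschitzPair g c₁ c₂) : Measurable (pastMean g) := 
  (StronglyMeasurable.limUnder (l := Filter.atTop) fun n =>
    (measurable_truncatedMean hg n).stronglyMeasurable).measurable

lemma measurePreserving_drop (n : ℕ) :
    MeasurePreserving (drop n : (ℕ → ℝ) → ℕ → ℝ) innov innov := by
  induction n with
  | zero => exact MeasurePreserving.id _
  | succ n ih =>
    exact ih.comp (measurePreserving_snd.comp (measurePreserving_head_tail unif))

/-- Almost surely the conditional mean can be recovered from the past observations, because the
influence of its value `n` steps ago is at most `c₂ ^ n` times its distance from `1`. -/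
theorem ae_mean_eq_pastMean (hg : LipschitzPair g c₁ c₂) (hc₂ : 0 < c₂) (hc₂' : c₂ < 1)
    (hh : Measurable h) (hint : Integrable (fun w => (h w : ℝ)) innov)
    (hrec : ∀ᵐ w ∂innov, h w = g (quantile (h (tail w)) r α (w 0)) (h (tail w))) :
    ∀ᵐ w ∂innov, h w = pastMean g (obs r α h w) := by
  have hall : ∀ᵐ w ∂innov, ∀ n,
      h (drop n w) = g (obs r α h w n) (h (drop (n + 1) w)) := by
    refine ae_all_iff.2 fun n => ?_
    filter_upwards [(measurePreserving_drop n).quasiMeasurePreserving.ae hrec] with w hw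
    have e1 : tail (drop n w) = drop (n + 1) w := by
      funext i; simp only [tail, drop]; congr 1; ring
    rw [hw, e1]
    simp [obs, drop]
  have hbound : ∀ n (w : ℕ → ℝ),
      (∀ n, h (drop n w) = g (obs r α h w n) (h (drop (n + 1) w))) →
      |(h w : ℝ) - truncatedMean g n (obs r α h w)| ≤ c₂ ^ n * |(h (drop n w) : ℝ) - 1| := by
    intro n
    induction n with
    | zero => intro w _; rw [pow_zero, one_mul]; exact le_rfl
    | succ n ih =>
      intro w hw
      have h1 := ih (tail w) fun m => hw (m + 1)
      have h0 : h w = g (obs r α h w 0) (h (tail w)) := hw 0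
      calc |(h w : ℝ) - truncatedMean g (n + 1) (obs r α h w)|
          = |(g (obs r α h w 0) (h (tail w)) : ℝ) -
              g (obs r α h w 0) (truncatedMean g n (obs r α h (tail w)))| := by
            rw [h0]; rfl
        _ ≤ c₂ * |(h (tail w) : ℝ) - truncatedMean g n (obs r α h (tail w))| := by
            simpa using hg (obs r α h w 0) (obs r α h w 0) (h (tail w))
              (truncatedMean g n (obs r α h (tail w)))
        _ ≤ c₂ * (c₂ ^ n * |(h (drop n (tail w)) : ℝ) - 1|) := by gcongr
        _ = c₂ ^ (n + 1) * |(h (drop (n + 1) w) : ℝ) - 1| := by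
            rw [pow_succ', mul_assoc]
            rfl
  have hsum : ∀ᵐ w ∂innov,
      ∑' n, ENNReal.ofReal c₂ ^ n * ‖(h (drop n w) : ℝ) - 1‖ₑ < ⊤ := by
    have hm : Measurable fun w => ‖(h w : ℝ) - 1‖ₑ := (hh.subtype_val.sub_const 1).enorm
    have hm' : ∀ n, Measurable fun w => ENNReal.ofReal c₂ ^ n * ‖(h (drop n w) : ℝ) - 1‖ₑ :=
      fun n => (hm.comp (measurable_drop n)).const_mul _
    refine ae_lt_top (Measurable.tsum hm') ?_
    rw [lintegral_tsum fun n => (hm' n).aemeasurable]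
    have : ∀ n, ∫⁻ w, ENNReal.ofReal c₂ ^ n * ‖(h (drop n w) : ℝ) - 1‖ₑ ∂innov =
        ENNReal.ofReal c₂ ^ n * ∫⁻ w, ‖(h w : ℝ) - 1‖ₑ ∂innov := fun n => by
      rw [lintegral_const_mul' _ _ (by simp),
        (measurePreserving_drop n).lintegral_comp hm]
    simp_rw [this]
    rw [ENNReal.tsum_mul_right, ENNReal.tsum_geometric]
    refine ENNReal.mul_ne_top ?_ ?_
    · rw [ENNReal.inv_ne_top]
      exact (tsub_pos_of_lt (by simpa using hc₂')).ne'
    · exact (hint.sub (integrable_const 1)).2.ne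
  filter_upwards [hall, hsum] with w hw hs
  have ht := ENNReal.tendsto_atTop_zero_of_tsum_ne_top hs.ne
  have ht' : Filter.Tendsto (fun n => truncatedMean g n (obs r α h w)) Filter.atTop
      (nhds (h w)) := by
    refine tendsto_iff_edist_tendsto_0.2 (tendsto_of_tendsto_of_tendsto_of_le_of_le
      tendsto_const_nhds ht (fun _ => zero_le) fun n => ?_)
    have := hbound n w hw
    rw [edist_comm, edist_dist, Subtype.dist_eq, Real.dist_eq, Real.enorm_eq_ofReal_abs,
      ← ENNReal.ofReal_pow hc₂.le, ← ENNReal.ofReal_mul (by positivity)]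
    exact ENNReal.ofReal_le_ofReal this
  exact ht'.limUnder_eq.symm

end Past

/-! ### The model equation in terms of laws -/

/-- The past observations `y (t - 1), y (t - 2), …`. -/
def pastObs {Ω : Type*} (y : ℤ → Ω → ℕ) (t : ℤ) (ω : Ω) : ℕ → ℕ := fun n => y (t - 1 - n) ω

lemma past_eq_comap {Ω : Type*} (y : ℤ → Ω → ℕ) (t : ℤ) :
    past y (t - 1) = MeasurableSpace.comap (pastObs y t) inferInstance := by
  simp only [past, MeasurableSpace.pi, MeasurableSpace.comap_iSup, MeasurableSpace.comap_comp]
  apply le_antisymm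
  · refine iSup₂_le fun s hs => ?_
    refine le_trans (le_of_eq ?_) (le_iSup _ (t - 1 - s).toNat)
    congr 1
    funext ω
    simp only [Function.comp, pastObs]
    congr 1
    omega
  · refine iSup_le fun n => ?_
    refine le_trans (le_of_eq ?_) (le_iSup₂ (t - 1 - n : ℤ) (by omega))
    rfl

section LawForm

variable {Ω : Type*} [MeasurableSpace Ω] {r α : ℝ}

lemma measurable_pastObs {y : ℤ → Ω → ℕ} (hy : ∀ t, Measurable (y t)) (t : ℤ) :
    Measurable (pastObs y t) := measurable_pi_lambda _ fun _ => hy _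

/-- The conditional law of `y t` given the past observations is beta negative binomial with mean
`γ (y (t - 1), y (t - 2), …)`, and this mean is `l t`. -/
structure IsPastMean (hr : 0 < r) (hα : 1 < α) (P : Measure Ω) (y : ℤ → Ω → ℕ)
    (l : ℤ → Ω → PosReal) (t : ℤ) (γ : (ℕ → ℕ) → PosReal) : Prop where
  measurable : Measurable γ
  ae_eq : ∀ᵐ ω ∂P, l t ω = γ (pastObs y t ω)
  map_eq : P.map (fun ω => (pastObs y t ω, y t ω)) =
    P.map (pastObs y t) ⊗ₘ Kernel.comap (bnbKernel hr hα) γ measurable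

lemma IsPastMean.condLaw {hr : 0 < r} {hα : 1 < α} {P : Measure Ω} [IsProbabilityMeasure P]
    {y : ℤ → Ω → ℕ} {l : ℤ → Ω → PosReal} {t : ℤ} {γ : (ℕ → ℕ) → PosReal}
    (hy : ∀ t, Measurable (y t)) (hγ : IsPastMean hr hα P y l t γ) (k : ℕ) :
    P[(y t ⁻¹' {k}).indicator (fun _ => (1 : ℝ)) | past y (t - 1)]
      =ᵐ[P] fun ω => pmf (l t ω) r α k := by
  have hX := measurable_pastObs hy t
  have h1 := condDistrib_ae_eq_condExp (μ := P) hX (hy t) (measurableSet_singleton k)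
  have h2 := (condDistrib_ae_eq_iff_measure_eq_compProd (μ := P) (pastObs y t)
    (hy t).aemeasurable (Kernel.comap (bnbKernel hr hα) γ hγ.measurable)).2 hγ.map_eq
  rw [past_eq_comap]
  refine h1.symm.trans ?_
  filter_upwards [ae_of_ae_map hX.aemeasurable h2, hγ.ae_eq] with ω hω hl
  rw [hω, hl, Kernel.comap_apply, measureReal_def, bnbKernel_singleton,
    ENNReal.toReal_ofReal (pmf_pos hr hα (Subtype.prop _) k).le]

/-- In any solution the conditional mean is a function of the past observations, since it can be
read off from the conditional law. -/
lemma IsSolution.exists_isPastMean (hr : 0 < r) (hα : 1 < α) {P : Measure Ω}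
    [IsProbabilityMeasure P] {g : ℕ → PosReal → PosReal} {y : ℤ → Ω → ℕ} {l : ℤ → Ω → PosReal}
    (h : IsSolution r α g P y l) (t : ℤ) : ∃ γ, IsPastMean hr hα P y l t γ := by
  have hX := measurable_pastObs h.measurable_y t
  set D := condDistrib (y t) (pastObs y t) P with hDdef
  have hD : ∀ᵐ ω ∂P, D (pastObs y t ω) = bnbKernel hr hα (l t ω) := by
    have hk : ∀ᵐ ω ∂P, ∀ k, (D (pastObs y t ω)).real {k} = pmf (l t ω) r α k := by
      refine ae_all_iff.2 fun k => ?_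
      have h1 := condDistrib_ae_eq_condExp (μ := P) hX (h.measurable_y t)
        (measurableSet_singleton k)
      rw [← past_eq_comap] at h1
      exact h1.trans (h.condLaw t k)
    filter_upwards [hk] with ω hω
    refine Measure.ext_of_singleton fun k => ?_
    rw [bnbKernel_singleton, ← hω k, measureReal_def, ENNReal.ofReal_toReal (measure_ne_top _ _)]
  let γ : (ℕ → ℕ) → PosReal := fun z => toPos (∫⁻ k, ENNReal.ofReal (k : ℝ) ∂(D z)).toReal
  have hγm : Measurable γ := measurable_toPos.comp
    (Measurable.lintegral_kernel (measurable_from_top)).ennreal_toReal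
  have hγ : ∀ᵐ ω ∂P, l t ω = γ (pastObs y t ω) := by
    filter_upwards [hD] with ω hω
    simp only [γ]
    rw [hω, lintegral_bnbKernel, ENNReal.toReal_ofReal (l t ω).2.le, toPos_coe]
  refine ⟨γ, hγm, hγ, (condDistrib_ae_eq_iff_measure_eq_compProd (μ := P) (pastObs y t)
    (h.measurable_y t).aemeasurable (Kernel.comap (bnbKernel hr hα) γ hγm)).1 ?_⟩
  have hset : MeasurableSet {z | D z = Kernel.comap (bnbKernel hr hα) γ hγm z} := by
    have : {z | D z = Kernel.comap (bnbKernel hr hα) γ hγm z} =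
        ⋂ k : ℕ, {z | D z {k} = Kernel.comap (bnbKernel hr hα) γ hγm z {k}} := by
      ext z
      simp only [Set.mem_ofPred_eq, Set.mem_iInter]
      exact ⟨fun h k => by rw [h], fun h => Measure.ext_of_singleton h⟩
    rw [this]
    exact MeasurableSet.iInter fun k => measurableSet_eq_fun
      (Kernel.measurable_coe _ (measurableSet_singleton k))
      (Kernel.measurable_coe _ (measurableSet_singleton k))
  refine (ae_map_iff hX.aemeasurable hset).2 ?_
  filter_upwards [hD, hγ] with ω h1 h2
  rw [h1, h2, Kernel.comap_apply]

end LawForm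

/-! ### Ergodicity of the Bernoulli shift -/

lemma iterate_shift {S : Type*} (n : ℕ) (x : ℤ → S) : shift^[n] x = fun t => x (t + n) := by
  induction n generalizing x with
  | zero => simp
  | succ n ih =>
    rw [Function.iterate_succ_apply, ih]
    funext t
    simp only [shift]
    congr 1
    push_cast
    ring

section Bernoulli

variable {S : Type*} [MeasurableSpace S]

lemma measurable_shift : Measurable (shift : (ℤ → S) → ℤ → S) :=
  measurable_pi_lambda _ fun _ => measurable_pi_apply _

lemma measurePreserving_translate (μ : Measure S) [IsProbabilityMeasure μ] (h : ℤ) :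
    MeasurePreserving (fun (x : ℤ → S) t => x (t + h)) (Measure.infinitePi fun _ : ℤ => μ)
      (Measure.infinitePi fun _ : ℤ => μ) :=
  ⟨measurable_pi_lambda _ fun _ => measurable_pi_apply _,
    Measure.map_infinitePi_infinitePi_of_inj (P := fun _ : ℤ => μ) (add_left_injective h)⟩

/-- A cylinder is independent of its image under a sufficiently long translation. -/
lemma exists_measure_inter_translate (μ : Measure S) [IsProbabilityMeasure μ] {C : Set (ℤ → S)}
    (hC : C ∈ measurableCylinders fun _ : ℤ => S) :
    ∃ n : ℕ, (Measure.infinitePi fun _ : ℤ => μ).real (C ∩ shift^[n] ⁻¹' C) =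
      (Measure.infinitePi fun _ : ℤ => μ).real C ^ 2 := by
  obtain ⟨I, B, hB, rfl⟩ := (mem_measurableCylinders C).1 hC
  set P := Measure.infinitePi fun _ : ℤ => μ
  obtain ⟨b, hb⟩ := I.bddAbove
  obtain ⟨a, ha⟩ := I.bddBelow
  obtain ⟨n, hn⟩ : ∃ n : ℕ, b - a < n := ⟨(b - a).toNat + 1, by omega⟩
  let J : Finset ℤ := I.image (· + (n : ℤ))
  have hIJ : Disjoint I J := by
    refine Finset.disjoint_left.2 fun i hi hj => ?_
    obtain ⟨j, hjI, rfl⟩ := Finset.mem_image.1 hj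
    have h1 := hb (Finset.mem_coe.2 hi)
    have h2 := ha (Finset.mem_coe.2 hjI)
    omega
  have hind : iIndepFun (fun (i : ℤ) (x : ℤ → S) => x i) P :=
    iIndepFun_infinitePi (P := fun _ : ℤ => μ) (X := fun _ x => x) fun _ => measurable_id
  have h2 := hind.indepFun_finset I J hIJ fun i => measurable_pi_apply i
  let B' : Set (J → S) :=
    {z | (fun i : I => z ⟨i + n, Finset.mem_image_of_mem _ i.2⟩) ∈ B}
  have hB' : MeasurableSet B' :=
    (measurable_pi_lambda _ fun _ => measurable_pi_apply _ : Measurable fun (z : J → S) (i : I) =>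
      z ⟨i + n, Finset.mem_image_of_mem _ i.2⟩) hB
  have hpre : shift^[n] ⁻¹' cylinder I B = (fun (x : ℤ → S) (i : J) => x i) ⁻¹' B' := by
    ext x
    rw [Set.mem_preimage, iterate_shift]
    rfl
  have hcyl : cylinder I B = (fun (x : ℤ → S) (i : I) => x i) ⁻¹' B := rfl
  have hmp : MeasurePreserving shift^[n] P P := by
    have := measurePreserving_translate μ n
    rwa [show (fun (x : ℤ → S) t => x (t + (n : ℤ))) = shift^[n] from
      funext fun x => (iterate_shift n x).symm] at this
  refine ⟨n, ?_⟩
  have h3 := h2.measure_inter_preimage_eq_mul B B' hB hB'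
  rw [← hpre, ← hcyl, hmp.measure_preimage hB.cylinder.nullMeasurableSet] at h3
  rw [measureReal_def, h3, ENNReal.toReal_mul, sq, measureReal_def]

/-- The two-sided shift of an i.i.d. sequence is ergodic: an invariant set is approximated by
cylinders, which are independent of their far translates, so its probability equals its own
square. -/
theorem ergodic_shift_infinitePi (μ : Measure S) [IsProbabilityMeasure μ] :
    Ergodic (shift : (ℤ → S) → ℤ → S) (Measure.infinitePi fun _ : ℤ => μ) := by
  set P := Measure.infinitePi fun _ : ℤ => μ with hP
  refine ⟨measurePreserving_translate μ 1, ⟨fun s hs hinv => ?_⟩⟩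
  have hsq : P.real s = P.real s ^ 2 := by
    refine eq_of_abs_sub_le_all fun ε hε => ?_
    obtain ⟨C, hC, hCs⟩ := exists_measure_symmDiff_lt_of_generateFrom_isSetRing (μ := P)
      (isSetRing_measurableCylinders (α := fun _ : ℤ => S))
      ⟨{Set.univ}, Set.countable_singleton _, by
        simpa using univ_mem_measurableCylinders (fun _ : ℤ => S), by simp⟩
      (generateFrom_measurableCylinders (α := fun _ : ℤ => S)).symm hs
      (ε := ENNReal.ofReal (ε / 4)) (by simpa using hε)
    obtain ⟨n, hn⟩ := exists_measure_inter_translate μ hC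
    have hCm := MeasurableSet.of_mem_measurableCylinders hC
    have hmp : MeasurePreserving shift^[n] P P := (measurePreserving_translate μ 1).iterate n
    have hd : P.real (symmDiff C s) ≤ ε / 4 :=
      (ENNReal.toReal_mono ENNReal.ofReal_ne_top hCs.le).trans_eq
        (ENNReal.toReal_ofReal (by positivity))
    have hsn : shift^[n] ⁻¹' s = s := Function.IsFixedPt.preimage_iterate hinv n
    have h1 : |P.real C - P.real s| ≤ ε / 4 := (abs_measureReal_sub_le_measureReal_symmDiff
      hCm.nullMeasurableSet hs.nullMeasurableSet).trans hd
    have h2 : |P.real (C ∩ shift^[n] ⁻¹' C) - P.real s| ≤ ε / 2 := by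
      have hsub : symmDiff (C ∩ shift^[n] ⁻¹' C) s ⊆
          symmDiff C s ∪ shift^[n] ⁻¹' symmDiff C s := by
        intro x hx
        have hxs : x ∈ s ↔ shift^[n] x ∈ s := by
          conv_lhs => rw [← hsn]
          rfl
        simp only [Set.mem_symmDiff, Set.mem_inter_iff, Set.mem_preimage, Set.mem_union] at hx ⊢
        tauto
      refine (abs_measureReal_sub_le_measureReal_symmDiff
        (hCm.inter (hmp.measurable hCm)).nullMeasurableSet hs.nullMeasurableSet).trans ?_
      refine (measureReal_mono hsub).trans ((measureReal_union_le _ _).trans ?_)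
      rw [hmp.measureReal_preimage (hCm.symmDiff hs).nullMeasurableSet]
      linarith
    rw [hn] at h2
    have h3 : P.real C ≤ 1 := measureReal_le_one
    have h4 : P.real s ≤ 1 := measureReal_le_one
    have h5 : 0 ≤ P.real C := measureReal_nonneg
    have h6 : 0 ≤ P.real s := measureReal_nonneg
    rw [abs_le] at h1 h2 ⊢
    constructor <;> nlinarith
  rw [Filter.eventuallyConst_set']
  have h01 : P.real s = 0 ∨ P.real s = 1 := by
    have : P.real s * (P.real s - 1) = 0 := by linarith
    rcases mul_eq_zero.1 this with h | h
    · exact Or.inl h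
    · exact Or.inr (by linarith)
  rcases h01 with h | h
  · exact Or.inl (ae_eq_empty.2 ((measureReal_eq_zero_iff).1 h))
  · refine Or.inr (Filter.eventuallyEq_univ.2 ?_)
    rw [mem_ae_iff, prob_compl_eq_zero_iff hs]
    rwa [measureReal_def, ENNReal.toReal_eq_one_iff] at h

end Bernoulli

/-! ### The causal solution -/

section Innovations

variable {Ω S : Type*} [MeasurableSpace Ω] [MeasurableSpace S] {P : Measure Ω}
  {u : ℤ → Ω → ℝ}

/-- The innovations `u t, u (t - 1), …`. -/
def innovPast {Ω : Type*} (u : ℤ → Ω → ℝ) (t : ℤ) (ω : Ω) : ℕ → ℝ := fun n => u (t - n) ω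

lemma tail_innovPast {Ω : Type*} (u : ℤ → Ω → ℝ) (t : ℤ) (ω : Ω) :
    tail (innovPast u t ω) = innovPast u (t - 1) ω := by
  funext n
  simp only [tail, innovPast]
  congr 1
  push_cast
  ring

lemma drop_innovPast {Ω : Type*} (u : ℤ → Ω → ℝ) (t : ℤ) (n : ℕ) (ω : Ω) :
    drop n (innovPast u t ω) = innovPast u (t - n) ω := by
  funext i
  simp only [drop, innovPast]
  congr 1
  push_cast
  ring

lemma innovPast_zero {Ω : Type*} (u : ℤ → Ω → ℝ) (t : ℤ) (ω : Ω) : innovPast u t ω 0 = u t ω := by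
  simp [innovPast]

lemma IsIIDUniform.measurePreserving_path (hu : IsIIDUniform P u) :
    MeasurePreserving (fun ω t => u t ω) P (Measure.infinitePi fun _ : ℤ => unif) := by
  refine ⟨measurable_pi_lambda _ hu.measurable, ?_⟩
  rw [hu.indep.map_fun_eq_infinitePi_map hu.measurable]
  simp_rw [hu.uniform]
  rfl

lemma IsIIDUniform.measurePreserving_innovPast (hu : IsIIDUniform P u) (t : ℤ) :
    MeasurePreserving (innovPast u t) P innov := by
  have hinj : Function.Injective fun n : ℕ => t - (n : ℤ) := fun a b h => by
    dsimp only at h; omega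
  have h : MeasurePreserving (fun (x : ℤ → ℝ) (n : ℕ) => x (t - n))
      (Measure.infinitePi fun _ : ℤ => unif) innov :=
    ⟨measurable_pi_lambda _ fun _ => measurable_pi_apply _,
      Measure.map_infinitePi_infinitePi_of_inj (P := fun _ : ℤ => unif) hinj⟩
  exact h.comp hu.measurePreserving_path

lemma IsIIDUniform.measurePreserving_prod (hu : IsIIDUniform P u) (t : ℤ) :
    MeasurePreserving (fun ω => (u t ω, innovPast u (t - 1) ω)) P (unif.prod innov) := by
  have h := (measurePreserving_head_tail unif).comp (hu.measurePreserving_innovPast t)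
  convert h using 2 with ω
  simp only [Function.comp]
  rw [tail_innovPast, innovPast_zero]

/-- The two-sided path of a causal process as a function of the path of the innovations. -/
def causalPath (H : (ℕ → ℝ) → S) (x : ℤ → ℝ) : ℤ → S := fun t => H fun n => x (t - n)

lemma measurable_causalPath {H : (ℕ → ℝ) → S} (hH : Measurable H) : Measurable (causalPath H) :=
  measurable_pi_lambda _ fun _ => hH.comp (measurable_pi_lambda _ fun _ => measurable_pi_apply _)

lemma causalPath_translate {S : Type*} (H : (ℕ → ℝ) → S) (x : ℤ → ℝ) (h : ℤ) :
    causalPath H (fun t => x (t + h)) = fun t => causalPath H x (t + h) := by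
  funext t
  simp only [causalPath]
  congr 1
  funext n
  congr 1
  ring

lemma IsIIDUniform.measurePreserving_causalPath (hu : IsIIDUniform P u) {H : (ℕ → ℝ) → S}
    (hH : Measurable H) :
    MeasurePreserving (causalPath H) (Measure.infinitePi fun _ : ℤ => unif)
      (pathLaw P fun t ω => H (innovPast u t ω)) := by
  refine ⟨measurable_causalPath hH, ?_⟩
  rw [← hu.measurePreserving_path.map_eq, Measure.map_map (measurable_causalPath hH)
    hu.measurePreserving_path.measurable]
  rfl

lemma IsIIDUniform.strictlyStationary (hu : IsIIDUniform P u) {H : (ℕ → ℝ) → S}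
    (hH : Measurable H) : StrictlyStationary P fun t ω => H (innovPast u t ω) := by
  intro h
  have h1 := hu.measurePreserving_causalPath hH
  have h2 := h1.comp (measurePreserving_translate unif h)
  rw [← h2.map_eq, ← hu.measurePreserving_path.map_eq, Measure.map_map h2.measurable
    hu.measurePreserving_path.measurable]
  unfold pathLaw
  congr 1
  funext ω t
  simp only [Function.comp]
  exact (congrFun (causalPath_translate H (fun t => u t ω) h) t).symm

lemma IsIIDUniform.ergodicProcess (hu : IsIIDUniform P u) {H : (ℕ → ℝ) → S}
    (hH : Measurable H) : ErgodicProcess P fun t ω => H (innovPast u t ω) :=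
  (hu.measurePreserving_causalPath hH).ergodic_of_ergodic_semiconj
    (ergodic_shift_infinitePi unif) measurable_shift fun x => causalPath_translate H x 1

end Innovations

section Causal

variable {Ω : Type*} [MeasurableSpace Ω] {P : Measure Ω} {u : ℤ → Ω → ℝ}
  {r α : ℝ} {g : ℕ → PosReal → PosReal} {c₁ c₂ : ℝ} {h : (ℕ → ℝ) → PosReal}

/-- The pair of observation and conditional mean as a function of the innovations, for a given mean
function `h` of the past innovations. -/
noncomputable def causalPair (r α : ℝ) (h : (ℕ → ℝ) → PosReal) (w : ℕ → ℝ) : ℕ × PosReal :=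
  (quantile (h (tail w)) r α (w 0), h (tail w))

/-- The observations of the causal process. -/
noncomputable def causalObs {Ω : Type*} (r α : ℝ) (h : (ℕ → ℝ) → PosReal) (u : ℤ → Ω → ℝ) (t : ℤ)
    (ω : Ω) : ℕ := (causalPair r α h (innovPast u t ω)).1

/-- The conditional means of the causal process. -/
noncomputable def causalMean {Ω : Type*} (r α : ℝ) (h : (ℕ → ℝ) → PosReal) (u : ℤ → Ω → ℝ) (t : ℤ)
    (ω : Ω) : PosReal := (causalPair r α h (innovPast u t ω)).2

lemma causalMean_eq {Ω : Type*} (u : ℤ → Ω → ℝ) (t : ℤ) (ω : Ω) :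
    causalMean r α h u t ω = h (innovPast u (t - 1) ω) := by
  rw [← tail_innovPast]
  rfl

lemma causalObs_eq {Ω : Type*} (u : ℤ → Ω → ℝ) (t : ℤ) (ω : Ω) :
    causalObs r α h u t ω = quantile (h (innovPast u (t - 1) ω)) r α (u t ω) := by
  rw [← tail_innovPast, ← innovPast_zero u t ω]
  rfl

lemma obs_innovPast {Ω : Type*} (u : ℤ → Ω → ℝ) (t : ℤ) (ω : Ω) :
    obs r α h (innovPast u (t - 1) ω) = pastObs (causalObs r α h u) t ω := by
  funext n
  simp only [obs, pastObs, causalObs_eq]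
  rw [drop_innovPast, show t - 1 - ((n + 1 : ℕ) : ℤ) = t - 1 - n - 1 by push_cast; ring]
  rfl

lemma measurable_causalPair (hr : 0 < r) (hα : 1 < α) (hh : Measurable h) :
    Measurable (causalPair r α h) := by
  have h1 : Measurable fun w : ℕ → ℝ => h (tail w) := hh.comp measurable_tail
  exact ((measurable_quantile hr hα).comp (h1.prodMk (measurable_pi_apply 0))).prodMk h1

lemma isDrivenSolution_causal (hr : 0 < r) (hα : 1 < α) (hu : IsIIDUniform P u)
    (hh : Measurable h)
    (hrec : ∀ᵐ w ∂innov, h w = g (quantile (h (tail w)) r α (w 0)) (h (tail w))) :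
    IsDrivenSolution r α g P u (causalObs r α h u) (causalMean r α h u) where
  measurable_y t := ((measurable_causalPair hr hα hh).comp
    (hu.measurePreserving_innovPast t).measurable).fst
  measurable_l t := ((measurable_causalPair hr hα hh).comp
    (hu.measurePreserving_innovPast t).measurable).snd
  observation t := Filter.Eventually.of_forall fun ω => by rw [causalObs_eq, causalMean_eq]
  recursion t := by
    filter_upwards [(hu.measurePreserving_innovPast t).quasiMeasurePreserving.ae hrec] with ω hω
    rw [causalMean_eq, causalMean_eq, causalObs_eq, add_sub_cancel_right, hω, tail_innovPast,
      innovPast_zero]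

lemma isPastMean_causal (hr : 0 < r) (hα : 1 < α) (hu : IsIIDUniform P u)
    (hg : LipschitzPair g c₁ c₂) (hc₂ : 0 < c₂) (hc₂' : c₂ < 1)
    (hh : Measurable h) (hint : Integrable (fun w => (h w : ℝ)) innov)
    (hrec : ∀ᵐ w ∂innov, h w = g (quantile (h (tail w)) r α (w 0)) (h (tail w))) (t : ℤ) :
    IsPastMean hr hα P (causalObs r α h u) (causalMean r α h u) t (pastMean g) := by
  have hpm := ae_mean_eq_pastMean hg hc₂ hc₂' hh hint hrec
  have hobs := measurable_obs hr hα hh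
  have hW := hu.measurePreserving_innovPast (t - 1)
  have hpast : pastObs (causalObs r α h u) t = fun ω => obs r α h (innovPast u (t - 1) ω) :=
    funext fun ω => (obs_innovPast u t ω).symm
  refine ⟨measurable_pastMean hg, ?_, ?_⟩
  · filter_upwards [hW.quasiMeasurePreserving.ae hpm] with ω hω
    rw [causalMean_eq, ← obs_innovPast, hω]
  · let f : ℝ × (ℕ → ℝ) → (ℕ → ℕ) × ℕ := fun p => (obs r α h p.2, quantile (h p.2) r α p.1)
    have hf : Measurable f := (hobs.comp measurable_snd).prodMk
      ((measurable_quantile hr hα).comp ((hh.comp measurable_snd).prodMk measurable_fst))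
    have h1 : P.map (fun ω => (pastObs (causalObs r α h u) t ω, causalObs r α h u t ω)) =
        (unif.prod innov).map f := by
      rw [← (hu.measurePreserving_prod t).map_eq,
        Measure.map_map hf (hu.measurePreserving_prod t).measurable]
      congr 1
      funext ω
      simp only [Function.comp, f]
      rw [obs_innovPast, causalObs_eq]
    have h2 : P.map (pastObs (causalObs r α h u) t) = innov.map (obs r α h) := by
      rw [hpast, ← hW.map_eq, Measure.map_map hobs hW.measurable]
      rfl
    rw [h1, h2]
    ext A hA
    rw [Measure.map_apply hf hA, Measure.prod_apply_symm (hf hA), Measure.compProd_apply hA,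
      lintegral_map (Kernel.measurable_kernel_prodMk_left hA) hobs]
    refine lintegral_congr_ae ?_
    filter_upwards [hpm] with w hw
    rw [Kernel.comap_apply, ← hw, bnbKernel_apply,
      Measure.map_apply (measurable_quantile_right hr hα _) (measurable_prodMk_left hA)]
    rfl

lemma isSolution_causal (hr : 0 < r) (hα : 1 < α) [IsProbabilityMeasure P]
    (hu : IsIIDUniform P u) (hg : LipschitzPair g c₁ c₂) (hc₂ : 0 < c₂) (hc₂' : c₂ < 1)
    (hh : Measurable h) (hint : Integrable (fun w => (h w : ℝ)) innov)
    (hrec : ∀ᵐ w ∂innov, h w = g (quantile (h (tail w)) r α (w 0)) (h (tail w))) :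
    IsSolution r α g P (causalObs r α h u) (causalMean r α h u) :=
  have hdr := isDrivenSolution_causal hr hα hu hh hrec
  ⟨hdr.measurable_y, hdr.measurable_l, fun t =>
    (isPastMean_causal hr hα hu hg hc₂ hc₂' hh hint hrec t).condLaw hdr.measurable_y,
    hdr.recursion⟩

lemma integrable_causalObs (hr : 0 < r) (hα : 1 < α) (hu : IsIIDUniform P u)
    (hh : Measurable h) (hint : Integrable (fun w => (h w : ℝ)) innov) (t : ℤ) :
    Integrable (fun ω => (causalObs r α h u t ω : ℝ)) P := by
  have hq : Measurable fun p : ℝ × (ℕ → ℝ) => (quantile (h p.2) r α p.1 : ℝ) :=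
    measurable_from_top.comp
      ((measurable_quantile hr hα).comp ((hh.comp measurable_snd).prodMk measurable_fst))
  have hmain : Integrable (fun p : ℝ × (ℕ → ℝ) => (quantile (h p.2) r α p.1 : ℝ))
      (unif.prod innov) := by
    refine ⟨hq.aestronglyMeasurable, ?_⟩
    rw [hasFiniteIntegral_iff_ofReal (Filter.Eventually.of_forall fun p => Nat.cast_nonneg _),
      lintegral_prod_symm _ hq.ennreal_ofReal.aemeasurable]
    simp_rw [lintegral_quantile hr hα]
    exact (hasFiniteIntegral_iff_ofReal (Filter.Eventually.of_forall fun w => (h w).2.le)).1 hint.2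
  have := (hu.measurePreserving_prod t).integrable_comp_of_integrable hmain
  refine this.congr (Filter.Eventually.of_forall fun ω => ?_)
  simp only [Function.comp]
  rw [causalObs_eq]

/-- A causal driven solution is almost surely the one built from the mean function `h`. -/
lemma ae_eq_causal (hr : 0 < r) (hα : 1 < α) (hu : IsIIDUniform P u)
    (hg : LipschitzPair g c₁ c₂) (hc₁ : 0 < c₁) (hc₂ : 0 < c₂) (hc : c₁ + c₂ < 1)
    (hh : Measurable h)
    (hrec : ∀ᵐ w ∂innov, h w = g (quantile (h (tail w)) r α (w 0)) (h (tail w)))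
    {y : ℤ → Ω → ℕ} {l : ℤ → Ω → PosReal} (hsol : IsDrivenSolution r α g P u y l)
    (hcausal : IsCausal P u (pair y l)) :
    ∀ᵐ ω ∂P, ∀ t, y t ω = causalObs r α h u t ω ∧ l t ω = causalMean r α h u t ω := by
  obtain ⟨H, hH, hHeq⟩ := hcausal
  let h' : (ℕ → ℝ) → PosReal := fun w => g (H w).1 (H w).2
  have hh' : Measurable h' := hg.measurable.comp hH
  have hl : ∀ t, ∀ᵐ ω ∂P, l t ω = h' (innovPast u (t - 1) ω) := by
    intro t
    filter_upwards [hsol.recursion (t - 1), hHeq (t - 1)] with ω h1 h2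
    rw [sub_add_cancel] at h1
    have h3 : H (innovPast u (t - 1) ω) = (y (t - 1) ω, l (t - 1) ω) := h2.symm
    simp only [h']
    rw [h1, h3]
  have hrec' : ∀ᵐ w ∂innov, h' w = g (quantile (h' (tail w)) r α (w 0)) (h' (tail w)) := by
    have hW := hu.measurePreserving_innovPast 0
    have hset : MeasurableSet
        {w | h' w = g (quantile (h' (tail w)) r α (w 0)) (h' (tail w))} :=
      measurableSet_eq_fun hh' ((measurable_next hr hα hg).comp
        ((hh'.comp measurable_tail).prodMk (measurable_pi_apply 0)))
    rw [← hW.map_eq]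
    refine (ae_map_iff hW.measurable.aemeasurable hset).2 ?_
    filter_upwards [hl (0 + 1), hl 0, hsol.recursion 0, hsol.observation 0] with ω h1 h2 h3 h4
    rw [add_sub_cancel_right] at h1
    rw [← h1, tail_innovPast, ← h2, innovPast_zero, h3, h4]
  have huniq := mean_function_unique hr hα hg hc₁ hc₂ hc hh hh' hrec hrec'
  refine ae_all_iff.2 fun t => ?_
  filter_upwards [hl t, hsol.observation t,
    (hu.measurePreserving_innovPast (t - 1)).quasiMeasurePreserving.ae huniq] with ω h1 h2 h3
  have h4 : l t ω = causalMean r α h u t ω := by rw [h1, h3, causalMean_eq]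
  refine ⟨?_, h4⟩
  rw [h2, h4, causalObs_eq, causalMean_eq]

end Causal

/-! ### Uniqueness of the stationary marginal law -/

section Marginal

variable {r α : ℝ} {g : ℕ → PosReal → PosReal} {c₁ c₂ : ℝ}

/-- The Markov operator of the conditional mean process. -/
noncomputable def meanOp (r α : ℝ) (g : ℕ → PosReal → PosReal) (f : PosReal → ℝ) (x : PosReal) :
    ℝ := ∫ v, f (g (quantile x r α v) x) ∂unif

/-- Functions bounded by `C` and Lipschitz with constant `L`. -/
def BoundedLip (C L : ℝ) (f : PosReal → ℝ) : Prop :=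
  (∀ x, |f x| ≤ C) ∧ ∀ x x' : PosReal, |f x - f x'| ≤ L * |(x : ℝ) - x'|

lemma BoundedLip.continuous {C L : ℝ} {f : PosReal → ℝ} (hf : BoundedLip C L f) :
    Continuous f := by
  refine continuous_iff_continuousAt.2 fun x => tendsto_iff_dist_tendsto_zero.2 ?_
  have h0 : Filter.Tendsto (fun y : PosReal => L * |(y : ℝ) - x|) (nhds x) (nhds 0) := by
    have : Continuous fun y : PosReal => L * |(y : ℝ) - x| := by fun_prop
    simpa using this.tendsto x
  exact squeeze_zero (fun _ => dist_nonneg) (fun y => hf.2 y x) h0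

lemma BoundedLip.integrable_comp {Ω : Type*} [MeasurableSpace Ω] {P : Measure Ω}
    [IsFiniteMeasure P] {C L : ℝ} {f : PosReal → ℝ} (hf : BoundedLip C L f) {X : Ω → PosReal}
    (hX : Measurable X) : Integrable (fun ω => f (X ω)) P :=
  Integrable.of_bound (hf.continuous.measurable.comp hX).aestronglyMeasurable C
    (Filter.Eventually.of_forall fun _ => hf.1 _)

/-- The Markov operator contracts Lipschitz constants. -/
lemma BoundedLip.meanOp (hr : 0 < r) (hα : 1 < α) (hg : LipschitzPair g c₁ c₂)
    (hc₁ : 0 < c₁) (hc₂ : 0 < c₂) {C L : ℝ} (hL : 0 ≤ L) {f : PosReal → ℝ}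
    (hf : BoundedLip C L f) : BoundedLip C ((c₁ + c₂) * L) (meanOp r α g f) := by
  constructor
  · intro x
    have := norm_integral_le_of_norm_le_const (μ := unif) (C := C)
      (f := fun v => f (g (quantile x r α v) x)) (Filter.Eventually.of_forall fun v => hf.1 _)
    simpa [BNB.meanOp] using this
  · intro x x'
    have hi := fun x : PosReal =>
      hf.integrable_comp (P := unif) (measurable_next_right hr hα hg x)
    have hd := integrable_dist_next hr hα hg hc₁ hc₂ x x'
    calc |BNB.meanOp r α g f x - BNB.meanOp r α g f x'|
        = |∫ v, (f (g (quantile x r α v) x) - f (g (quantile x' r α v) x')) ∂unif| := by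
          rw [BNB.meanOp, BNB.meanOp, integral_sub (hi x) (hi x')]
      _ ≤ ∫ v, |f (g (quantile x r α v) x) - f (g (quantile x' r α v) x')| ∂unif :=
          abs_integral_le_integral_abs
      _ ≤ ∫ v, L * |(g (quantile x r α v) x : ℝ) - g (quantile x' r α v) x'| ∂unif :=
          integral_mono ((hi x).sub (hi x')).abs (hd.const_mul L) fun v => hf.2 _ _
      _ ≤ L * ((c₁ + c₂) * |(x : ℝ) - x'|) := by
          rw [integral_const_mul]
          exact mul_le_mul_of_nonneg_left (integral_dist_next_le hr hα hg hc₁ hc₂ x x') hL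
      _ = (c₁ + c₂) * L * |(x : ℝ) - x'| := by ring

/-- `π` is invariant for the conditional mean process. -/
def IsInvariantMean (r α : ℝ) (g : ℕ → PosReal → PosReal) (π : Measure PosReal) : Prop :=
  (π.prod unif).map (fun p => g (quantile p.1 r α p.2) p.1) = π

lemma IsInvariantMean.integral_meanOp (hr : 0 < r) (hα : 1 < α) (hg : LipschitzPair g c₁ c₂)
    {π : Measure PosReal} [IsProbabilityMeasure π] (hπ : IsInvariantMean r α g π) {C L : ℝ}
    {f : PosReal → ℝ} (hf : BoundedLip C L f) : ∫ x, meanOp r α g f x ∂π = ∫ x, f x ∂π := by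
  have hN := measurable_next hr hα hg
  conv_rhs => rw [← hπ]
  rw [integral_map hN.aemeasurable hf.continuous.aestronglyMeasurable,
    integral_prod _ (hf.integrable_comp hN)]
  rfl

/-- The iterates of the Markov operator flatten a bounded Lipschitz function, so they converge to
its integral against any invariant law. -/
lemma IsInvariantMean.tendsto_iterate (hr : 0 < r) (hα : 1 < α) (hg : LipschitzPair g c₁ c₂)
    (hc₁ : 0 < c₁) (hc₂ : 0 < c₂) (hc : c₁ + c₂ < 1)
    {π : Measure PosReal} [IsProbabilityMeasure π] (hπ : IsInvariantMean r α g π) {C L : ℝ}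
    (hL : 0 ≤ L) {f : PosReal → ℝ} (hf : BoundedLip C L f) (x₀ : PosReal) :
    Filter.Tendsto (fun n => (meanOp r α g)^[n] f x₀) Filter.atTop (nhds (∫ x, f x ∂π)) := by
  have hc0 : 0 < c₁ + c₂ := by positivity
  have hit : ∀ n, BoundedLip C ((c₁ + c₂) ^ n * L) ((meanOp r α g)^[n] f) ∧
      ∫ x, (meanOp r α g)^[n] f x ∂π = ∫ x, f x ∂π := by
    intro n
    induction n with
    | zero => simpa using hf
    | succ n ih =>
      rw [Function.iterate_succ_apply']
      refine ⟨?_, (hπ.integral_meanOp hr hα hg ih.1).trans ih.2⟩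
      have := ih.1.meanOp hr hα hg hc₁ hc₂ (by positivity)
      rwa [← mul_assoc, ← pow_succ'] at this
  have hlim : Filter.Tendsto (fun n => ∫ x, ((meanOp r α g)^[n] f x₀ - (meanOp r α g)^[n] f x) ∂π)
      Filter.atTop (nhds (∫ _, (0 : ℝ) ∂π)) := by
    refine tendsto_integral_of_dominated_convergence (fun _ => C + C) (fun n => ?_)
      (integrable_const _) (fun n => Filter.Eventually.of_forall fun x => ?_)
      (Filter.Eventually.of_forall fun x => ?_)
    · exact (continuous_const.sub (hit n).1.continuous).aestronglyMeasurable
    · exact (norm_sub_le _ _).trans (add_le_add ((hit n).1.1 _) ((hit n).1.1 _))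
    · refine squeeze_zero_norm (fun n => (hit n).1.2 x₀ x) ?_
      have := (tendsto_pow_atTop_nhds_zero_of_lt_one hc0.le hc).mul_const (L * |(x₀ : ℝ) - x|)
      simpa [mul_assoc] using this
  have heq : ∀ n, ∫ x, ((meanOp r α g)^[n] f x₀ - (meanOp r α g)^[n] f x) ∂π =
      (meanOp r α g)^[n] f x₀ - ∫ x, f x ∂π := fun n => by
    have hi : Integrable ((meanOp r α g)^[n] f) π := (hit n).1.integrable_comp measurable_id
    rw [integral_sub (integrable_const _) hi, (hit n).2]
    simp
  simp_rw [heq] at hlim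
  simpa using hlim.add_const (∫ x, f x ∂π)

theorem IsInvariantMean.unique (hr : 0 < r) (hα : 1 < α) (hg : LipschitzPair g c₁ c₂)
    (hc₁ : 0 < c₁) (hc₂ : 0 < c₂) (hc : c₁ + c₂ < 1) {π π' : Measure PosReal}
    [hp : IsProbabilityMeasure π] [hp' : IsProbabilityMeasure π'] (hπ : IsInvariantMean r α g π)
    (hπ' : IsInvariantMean r α g π') : π = π' := by
  let p : ProbabilityMeasure PosReal := ⟨π, hp⟩
  let p' : ProbabilityMeasure PosReal := ⟨π', hp'⟩
  have hconst : Filter.Tendsto (fun _ : ℕ => p) Filter.atTop (nhds p') := by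
    refine tendsto_iff_forall_lipschitz_integral_tendsto.2 fun f ⟨C, hC⟩ ⟨L, hL⟩ => ?_
    have x₀ : PosReal := ⟨1, one_pos⟩
    have hf : BoundedLip (|f x₀| + C) L f := by
      refine ⟨fun x => ?_, fun x x' => hL.dist_le_mul x x'⟩
      have h1 := hC x x₀
      rw [Real.dist_eq] at h1
      have h2 := abs_sub_abs_le_abs_sub (f x) (f x₀)
      linarith
    have h1 := hπ.tendsto_iterate hr hα hg hc₁ hc₂ hc L.2 hf x₀
    have h2 := hπ'.tendsto_iterate hr hα hg hc₁ hc₂ hc L.2 hf x₀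
    have h3 : ∫ x, f x ∂π = ∫ x, f x ∂π' := tendsto_nhds_unique h1 h2
    change Filter.Tendsto (fun _ : ℕ => ∫ x, f x ∂π) _ (nhds (∫ x, f x ∂π'))
    rw [h3]
    exact tendsto_const_nhds
  have := tendsto_nhds_unique (tendsto_const_nhds (x := p)) hconst
  exact congrArg (fun q : ProbabilityMeasure PosReal => (q : Measure PosReal)) this

end Marginal

/-! ### Uniqueness of the stationary law -/

section Law

variable {Ω : Type*} [MeasurableSpace Ω] {P : Measure Ω}
  {r α : ℝ} {g : ℕ → PosReal → PosReal} {c₁ c₂ : ℝ} {y : ℤ → Ω → ℕ} {l : ℤ → Ω → PosReal}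

lemma measurable_pair (hsol : IsSolution r α g P y l) (t : ℤ) : Measurable (pair y l t) :=
  (hsol.measurable_y t).prodMk (hsol.measurable_l t)

lemma StrictlyStationary.map_mean_eq (hsol : IsSolution r α g P y l)
    (hst : StrictlyStationary P (pair y l)) (t : ℤ) : P.map (l t) = P.map (l 0) := by
  have hev : Measurable fun x : ℤ → ℕ × PosReal => (x 0).2 := (measurable_pi_apply 0).snd
  have h1 := congrArg (fun μ => Measure.map (fun x : ℤ → ℕ × PosReal => (x 0).2) μ) (hst t)
  simp only [pathLaw] at h1
  rw [Measure.map_map hev (measurable_pi_lambda _ fun s => measurable_pair hsol _),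
    Measure.map_map hev (measurable_pi_lambda _ fun s => measurable_pair hsol _)] at h1
  simpa [Function.comp_def, pair] using h1

/-- The values at the times `t, t - 1, …, t - n`. -/
def block {Ω S : Type*} (X : ℤ → Ω → S) (n : ℕ) (t : ℤ) (ω : Ω) : Fin (n + 1) → S :=
  fun i => X (t - (i : ℕ)) ω

lemma measurable_block (hsol : IsSolution r α g P y l) (n : ℕ) (t : ℤ) :
    Measurable (block (pair y l) n t) :=
  measurable_pi_lambda _ fun _ => measurable_pair hsol _

variable [IsProbabilityMeasure P]

/-- If the conditional mean `l t` is a function `φ` of a random variable `Z` that depends only on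
the past observations, then `y t` given `Z` is beta negative binomial with mean `φ Z`. -/
lemma IsSolution.map_prodMk {E : Type*} [MeasurableSpace E] (hr : 0 < r) (hα : 1 < α)
    (hsol : IsSolution r α g P y l) (t : ℤ) {Z : Ω → E} (hZ : Measurable Z) {ζ : (ℕ → ℕ) → E}
    (hζ : Measurable ζ) (hZζ : ∀ᵐ ω ∂P, Z ω = ζ (pastObs y t ω)) {φ : E → PosReal}
    (hφ : Measurable φ) (hlφ : ∀ᵐ ω ∂P, l t ω = φ (Z ω)) :
    P.map (fun ω => (Z ω, y t ω)) = P.map Z ⊗ₘ Kernel.comap (bnbKernel hr hα) φ hφ := by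
  obtain ⟨γ, hγ⟩ := hsol.exists_isPastMean hr hα t
  have hX := measurable_pastObs hsol.measurable_y t
  have hm : Measurable fun p : (ℕ → ℕ) × ℕ => (ζ p.1, p.2) :=
    (hζ.comp measurable_fst).prodMk measurable_snd
  have h1 : P.map (fun ω => (Z ω, y t ω)) =
      (P.map fun ω => (pastObs y t ω, y t ω)).map fun p => (ζ p.1, p.2) := by
    rw [Measure.map_map hm (hX.prodMk (hsol.measurable_y t))]
    refine Measure.map_congr ?_
    filter_upwards [hZζ] with ω hω
    simp only [Function.comp]
    rw [hω]
  rw [h1, hγ.map_eq]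
  ext A hA
  rw [Measure.map_apply hm hA, Measure.compProd_apply (hm hA), Measure.compProd_apply hA,
    lintegral_map (Kernel.measurable_kernel_prodMk_left (hm hA)) hX,
    lintegral_map (Kernel.measurable_kernel_prodMk_left hA) hZ]
  refine lintegral_congr_ae ?_
  filter_upwards [hZζ, hlφ, hγ.ae_eq] with ω h2 h3 h4
  rw [Kernel.comap_apply, Kernel.comap_apply, ← h3, ← h4, h2]
  rfl

lemma IsSolution.map_mean_prodMk (hr : 0 < r) (hα : 1 < α) (hsol : IsSolution r α g P y l)
    (t : ℤ) : P.map (fun ω => (l t ω, y t ω)) = P.map (l t) ⊗ₘ bnbKernel hr hα := by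
  obtain ⟨γ, hγ⟩ := hsol.exists_isPastMean hr hα t
  exact hsol.map_prodMk hr hα t (hsol.measurable_l t) hγ.measurable hγ.ae_eq measurable_id
    (Filter.Eventually.of_forall fun _ => rfl)

lemma IsSolution.isInvariantMean (hr : 0 < r) (hα : 1 < α) (hg : LipschitzPair g c₁ c₂)
    (hsol : IsSolution r α g P y l) (hst : StrictlyStationary P (pair y l)) :
    IsInvariantMean r α g (P.map (l 0)) := by
  have hq : Measurable fun p : PosReal × ℝ => (p.1, quantile p.1 r α p.2) :=
    measurable_fst.prodMk (measurable_quantile hr hα)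
  have hprod : ((P.map (l 0)).prod unif).map (fun p => (p.1, quantile p.1 r α p.2)) =
      P.map (l 0) ⊗ₘ bnbKernel hr hα := by
    ext A hA
    rw [Measure.map_apply hq hA, Measure.prod_apply (hq hA), Measure.compProd_apply hA]
    refine lintegral_congr fun x => ?_
    rw [bnbKernel_apply, Measure.map_apply (measurable_quantile_right hr hα _)
      (measurable_prodMk_left hA)]
    rfl
  have hG : Measurable fun p : PosReal × ℕ => g p.2 p.1 :=
    hg.measurable.comp measurable_swap
  calc (((P.map (l 0)).prod unif).map fun p => g (quantile p.1 r α p.2) p.1)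
      = (((P.map (l 0)).prod unif).map fun p => (p.1, quantile p.1 r α p.2)).map
          fun p => g p.2 p.1 := by
        rw [Measure.map_map hG hq]
        rfl
    _ = (P.map fun ω => (l 0 ω, y 0 ω)).map fun p => g p.2 p.1 := by
        rw [hprod, hsol.map_mean_prodMk hr hα 0]
    _ = P.map (l (0 + 1)) := by
        rw [Measure.map_map hG ((hsol.measurable_l 0).prodMk (hsol.measurable_y 0))]
        refine Measure.map_congr ?_
        filter_upwards [hsol.recursion 0] with ω hω
        rw [hω]
        rfl
    _ = P.map (l 0) := StrictlyStationary.map_mean_eq hsol hst _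

/-- Finitely many earlier values of the process are a function of the past observations. -/
lemma IsSolution.exists_block_eq (hr : 0 < r) (hα : 1 < α) (hsol : IsSolution r α g P y l)
    (n : ℕ) (t : ℤ) : ∃ ζ : (ℕ → ℕ) → Fin (n + 1) → ℕ × PosReal, Measurable ζ ∧
      ∀ᵐ ω ∂P, block (pair y l) n (t - 1) ω = ζ (pastObs y t ω) := by
  choose γ hγ using hsol.exists_isPastMean hr hα
  refine ⟨fun z i => (z i, γ (t - 1 - (i : ℕ)) (drop (i + 1) z)), ?_, ?_⟩
  · exact measurable_pi_lambda _ fun i => (measurable_pi_apply _).prodMk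
      ((hγ _).measurable.comp (measurable_drop _))
  · filter_upwards [ae_all_iff.2 fun s => (hγ s).ae_eq] with ω hω
    funext i
    simp only [block, pair]
    refine Prod.ext rfl ?_
    simp only
    rw [hω]
    congr 1
    funext m
    simp only [pastObs, drop]
    congr 1
    push_cast
    ring

lemma IsSolution.map_block_zero (hr : 0 < r) (hα : 1 < α) (hsol : IsSolution r α g P y l)
    (t : ℤ) : P.map (block (pair y l) 0 t) =
      (P.map (l t) ⊗ₘ bnbKernel hr hα).map fun p (_ : Fin (0 + 1)) => (p.2, p.1) := by
  have hm : Measurable fun (p : PosReal × ℕ) (_ : Fin (0 + 1)) => (p.2, p.1) :=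
    measurable_pi_lambda _ fun _ => measurable_swap
  rw [← hsol.map_mean_prodMk hr hα, Measure.map_map hm
    ((hsol.measurable_l t).prodMk (hsol.measurable_y t))]
  congr 1
  funext ω i
  simp [block, pair]

lemma measurable_nextMean (hg : LipschitzPair g c₁ c₂) (n : ℕ) :
    Measurable fun z : Fin (n + 1) → ℕ × PosReal => g (z 0).1 (z 0).2 :=
  hg.measurable.comp (measurable_pi_apply 0)

/-- The block starting at `t` is obtained from the block starting at `t - 1` by drawing a new
observation from the beta negative binomial distribution with the updated mean. -/
lemma IsSolution.map_block_succ (hr : 0 < r) (hα : 1 < α) (hg : LipschitzPair g c₁ c₂)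
    (hsol : IsSolution r α g P y l) (n : ℕ) (t : ℤ) :
    P.map (block (pair y l) (n + 1) t) =
      (P.map (block (pair y l) n (t - 1)) ⊗ₘ
        Kernel.comap (bnbKernel hr hα) _ (measurable_nextMean hg n)).map
      fun p => (Fin.cons (p.2, g (p.1 0).1 (p.1 0).2) p.1 : Fin (n + 1 + 1) → ℕ × PosReal) := by
  obtain ⟨ζ, hζ, hZ⟩ := hsol.exists_block_eq hr hα n t
  have hrec : ∀ᵐ ω ∂P, l t ω =
      g (block (pair y l) n (t - 1) ω 0).1 (block (pair y l) n (t - 1) ω 0).2 := by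
    filter_upwards [hsol.recursion (t - 1)] with ω hω
    rw [sub_add_cancel] at hω
    simpa [block, pair] using hω
  have hB := measurable_block hsol n (t - 1)
  have hm : Measurable fun p : (Fin (n + 1) → ℕ × PosReal) × ℕ =>
      (Fin.cons (p.2, g (p.1 0).1 (p.1 0).2) p.1 : Fin (n + 1 + 1) → ℕ × PosReal) := by
    refine measurable_pi_lambda _ fun i => ?_
    refine Fin.cases ?_ (fun j => ?_) i
    · simp only [Fin.cons_zero]
      exact measurable_snd.prodMk ((measurable_nextMean hg n).comp measurable_fst)
    · simp only [Fin.cons_succ]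
      exact (measurable_pi_apply j).comp measurable_fst
  rw [← hsol.map_prodMk hr hα t hB hζ hZ (measurable_nextMean hg n) hrec,
    Measure.map_map hm (hB.prodMk (hsol.measurable_y t))]
  refine Measure.map_congr ?_
  filter_upwards [hrec] with ω hω
  funext i
  refine Fin.cases ?_ (fun j => ?_) i
  · simp only [Function.comp, Fin.cons_zero, ← hω]
    simp [block, pair]
  · simp only [Function.comp, Fin.cons_succ]
    simp only [block, Fin.val_succ]
    congr 1
    push_cast
    ring

variable {Ω' : Type*} [MeasurableSpace Ω'] {P' : Measure Ω'} [IsProbabilityMeasure P']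
  {y' : ℤ → Ω' → ℕ} {l' : ℤ → Ω' → PosReal}

lemma IsSolution.map_block_eq (hr : 0 < r) (hα : 1 < α) (hg : LipschitzPair g c₁ c₂)
    (hsol : IsSolution r α g P y l) (hsol' : IsSolution r α g P' y' l')
    (hl : ∀ t, P.map (l t) = P'.map (l' t)) (n : ℕ) (t : ℤ) :
    P.map (block (pair y l) n t) = P'.map (block (pair y' l') n t) := by
  induction n generalizing t with
  | zero => rw [hsol.map_block_zero hr hα, hsol'.map_block_zero hr hα, hl]
  | succ n ih =>
    rw [hsol.map_block_succ hr hα hg, hsol'.map_block_succ hr hα hg, ih]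

/-- Any two strictly stationary solutions have the same law. -/
theorem IsSolution.pathLaw_eq (hr : 0 < r) (hα : 1 < α) (hg : LipschitzPair g c₁ c₂)
    (hc₁ : 0 < c₁) (hc₂ : 0 < c₂) (hc : c₁ + c₂ < 1)
    (hsol : IsSolution r α g P y l) (hst : StrictlyStationary P (pair y l))
    (hsol' : IsSolution r α g P' y' l') (hst' : StrictlyStationary P' (pair y' l')) :
    pathLaw P (pair y l) = pathLaw P' (pair y' l') := by
  have := Measure.isProbabilityMeasure_map (μ := P) (hsol.measurable_l 0).aemeasurable
  have := Measure.isProbabilityMeasure_map (μ := P') (hsol'.measurable_l 0).aemeasurable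
  have hπ : P.map (l 0) = P'.map (l' 0) :=
    (hsol.isInvariantMean hr hα hg hst).unique hr hα hg hc₁ hc₂ hc
      (hsol'.isInvariantMean hr hα hg hst')
  have hl : ∀ t, P.map (l t) = P'.map (l' t) := fun t => by
    rw [StrictlyStationary.map_mean_eq hsol hst t, hπ, StrictlyStationary.map_mean_eq hsol' hst' t]
  have hX : Measurable fun ω t => pair y l t ω := measurable_pi_lambda _ (measurable_pair hsol)
  have hX' : Measurable fun ω t => pair y' l' t ω :=
    measurable_pi_lambda _ (measurable_pair hsol')
  have := Measure.isProbabilityMeasure_map (μ := P) hX.aemeasurable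
  have hproj : IsProjectiveLimit (pathLaw P (pair y l)) fun I : Finset ℤ =>
      (pathLaw P (pair y l)).map I.restrict := fun I => rfl
  have : ∀ I : Finset ℤ, IsFiniteMeasure ((pathLaw P (pair y l)).map I.restrict) := fun I => by
    unfold pathLaw; infer_instance
  refine hproj.unique fun I => ?_
  -- a finite set of times lies in the window `b - n, …, b`
  obtain ⟨b, hb⟩ := I.bddAbove
  obtain ⟨a, ha⟩ := I.bddBelow
  have hI : ∀ i : I, (b - i).toNat < (b - a).toNat + 1 := fun i => by
    have h1 : a ≤ i := ha i.2
    omega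
  let π : (Fin ((b - a).toNat + 1) → ℕ × PosReal) → I → ℕ × PosReal :=
    fun z i => z ⟨(b - i).toNat, hI i⟩
  have hm : Measurable π := measurable_pi_lambda _ fun _ => measurable_pi_apply _
  have hi : ∀ i : I, b - ((b - i).toNat : ℤ) = i := fun i => by
    have h1 : (i : ℤ) ≤ b := hb i.2
    omega
  have e : P.map (fun ω => I.restrict fun t => pair y l t ω) =
      (P.map (block (pair y l) (b - a).toNat b)).map π := by
    rw [Measure.map_map hm (measurable_block hsol _ _)]
    congr 1
    funext ω i
    simp only [Function.comp, π, block, Finset.restrict, hi]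
  have e' : P'.map (fun ω => I.restrict fun t => pair y' l' t ω) =
      (P'.map (block (pair y' l') (b - a).toNat b)).map π := by
    rw [Measure.map_map hm (measurable_block hsol' _ _)]
    congr 1
    funext ω i
    simp only [Function.comp, π, block, Finset.restrict, hi]
  simp only [pathLaw]
  rw [Measure.map_map (Finset.measurable_restrict I) hX,
    Measure.map_map (Finset.measurable_restrict I) hX']
  exact e'.trans ((congrArg _ (hsol.map_block_eq hr hα hg hsol' hl _ _).symm).trans e.symm)

end Law

/-! ### Passage to the path space -/

section PathSpace

variable {Ω : Type*} [MeasurableSpace Ω] {P : Measure Ω} {r α : ℝ}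
  {g : ℕ → PosReal → PosReal} {c₁ c₂ : ℝ} {y : ℤ → Ω → ℕ} {l : ℤ → Ω → PosReal}

lemma measurable_path (hsol : IsSolution r α g P y l) : Measurable fun ω t => pair y l t ω :=
  measurable_pi_lambda _ (measurable_pair hsol)

lemma measurable_coord_fst (t : ℤ) : Measurable fun x : ℤ → ℕ × PosReal => (x t).1 :=
  (measurable_pi_apply t).fst

lemma measurable_coord_snd (t : ℤ) : Measurable fun x : ℤ → ℕ × PosReal => (x t).2 :=
  (measurable_pi_apply t).snd

lemma measurableSet_eq_pastMean (hg : LipschitzPair g c₁ c₂) (t : ℤ) :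
    MeasurableSet {x : ℤ → ℕ × PosReal |
      (x t).2 = pastMean g (pastObs (fun t (x : ℤ → ℕ × PosReal) => (x t).1) t x)} :=
  measurableSet_eq_fun (measurable_coord_snd t)
    ((measurable_pastMean hg).comp (measurable_pastObs measurable_coord_fst t))

lemma IsPastMean.pathLaw {hr : 0 < r} {hα : 1 < α} (hg : LipschitzPair g c₁ c₂)
    (hsol : IsSolution r α g P y l) {t : ℤ} (h : IsPastMean hr hα P y l t (pastMean g)) :
    IsPastMean hr hα (pathLaw P (pair y l)) (fun t x => (x t).1) (fun t x => (x t).2) t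
      (pastMean g) := by
  have hX := measurable_path hsol
  have hp := measurable_pastObs measurable_coord_fst t
  refine ⟨h.measurable, (ae_map_iff hX.aemeasurable (measurableSet_eq_pastMean hg t)).2 h.ae_eq, ?_⟩
  simp only [BNB.pathLaw]
  rw [Measure.map_map (hp.prodMk (measurable_coord_fst t)) hX, Measure.map_map hp hX]
  exact h.map_eq

/-- A solution whose conditional mean is `pastMean g` of the past yields a solution on the path
space. -/
lemma IsSolution.pathLaw (hr : 0 < r) (hα : 1 < α) [IsProbabilityMeasure P]
    (hg : LipschitzPair g c₁ c₂) (hsol : IsSolution r α g P y l)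
    (h : ∀ t, IsPastMean hr hα P y l t (pastMean g)) :
    IsSolution r α g (pathLaw P (pair y l)) (fun t x => (x t).1) (fun t x => (x t).2) where
  measurable_y := measurable_coord_fst
  measurable_l := measurable_coord_snd
  condLaw t k := by
    have : IsProbabilityMeasure (BNB.pathLaw P (pair y l)) :=
      Measure.isProbabilityMeasure_map (measurable_path hsol).aemeasurable
    exact ((h t).pathLaw hg hsol).condLaw measurable_coord_fst k
  recursion t := by
    have hset : MeasurableSet {x : ℤ → ℕ × PosReal | (x (t + 1)).2 = g (x t).1 (x t).2} :=
      measurableSet_eq_fun (measurable_coord_snd _) (hg.measurable.comp (measurable_pi_apply t))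
    exact (ae_map_iff (measurable_path hsol).aemeasurable hset).2 (hsol.recursion t)

lemma pathLaw_coord {S : Type*} [MeasurableSpace S] (μ : Measure (ℤ → S)) :
    pathLaw μ (fun t x => x t) = μ := Measure.map_id

lemma StrictlyStationary.pathLaw {S : Type*} [MeasurableSpace S] {X : ℤ → Ω → S}
    (hX : ∀ t, Measurable (X t)) (h : StrictlyStationary P X) :
    StrictlyStationary (pathLaw P X) fun t x => x t := by
  intro s
  rw [pathLaw_coord]
  refine Eq.trans ?_ (h s)
  have hm : Measurable fun (x : ℤ → S) t => x (t + s) :=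
    measurable_pi_lambda _ fun _ => measurable_pi_apply _
  simp only [BNB.pathLaw]
  rw [Measure.map_map hm (measurable_pi_lambda _ hX)]
  rfl

end PathSpace

lemma isIIDUniform_coord :
    IsIIDUniform (Measure.infinitePi fun _ : ℤ => unif) fun t (x : ℤ → ℝ) => x t where
  measurable := measurable_pi_apply
  indep := iIndepFun_infinitePi (P := fun _ : ℤ => unif) (X := fun _ x => x)
    fun _ => measurable_id
  uniform t := Measure.infinitePi_map_eval (fun _ : ℤ => unif) t

end BNB

/-! ### Existence and uniqueness of the stationary solution -/

theorem theorem1 (r α : ℝ) (hr : 0 < r) (hα : 1 < α)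
    (g : ℕ → BNB.PosReal → BNB.PosReal)
    (c₁ c₂ : ℝ) (hc₁ : 0 < c₁) (hc₂ : 0 < c₂) (hc : c₁ + c₂ < 1)
    (hg : ∀ (k k' : ℕ) (x x' : BNB.PosReal),
      |(g k x : ℝ) - (g k' x' : ℝ)| ≤ c₁ * |(k : ℝ) - (k' : ℝ)| + c₂ * |(x : ℝ) - (x' : ℝ)|)
    -- the limit of `g 0 x` as `x` decreases to `0` is positive
    (hg0 : ∃ ε : ℝ, 0 < ε ∧ ∃ δ : ℝ, 0 < δ ∧ ∀ x : BNB.PosReal, (x : ℝ) < δ → ε ≤ (g 0 x : ℝ)) :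
    -- (i) there is a stationary and ergodic solution with a finite first moment, and every
    -- strictly stationary solution, on whatever probability space, has the same law
    (∃ μ : Measure (ℤ → ℕ × BNB.PosReal), IsProbabilityMeasure μ ∧
      BNB.IsSolution r α g μ (fun t x => (x t).1) (fun t x => (x t).2) ∧
      BNB.StrictlyStationary μ (fun t x => x t) ∧
      BNB.ErgodicProcess μ (fun t x => x t) ∧
      (∀ t : ℤ, Integrable (fun x => ((x t).1 : ℝ)) μ) ∧
      ∀ (Ω : Type w) [MeasurableSpace Ω] (P : Measure Ω) [IsProbabilityMeasure P]
        (y : ℤ → Ω → ℕ) (l : ℤ → Ω → BNB.PosReal),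
        BNB.IsSolution r α g P y l → BNB.StrictlyStationary P (BNB.pair y l) →
        BNB.pathLaw P (BNB.pair y l) = μ) ∧
    -- (i) given i.i.d. uniform innovations, there is such a solution that is causal, and it is
    -- almost surely the only strictly stationary causal solution
    (∀ (Ω : Type w) [MeasurableSpace Ω] (P : Measure Ω) [IsProbabilityMeasure P]
      (u : ℤ → Ω → ℝ), BNB.IsIIDUniform P u →
      ∃ (y : ℤ → Ω → ℕ) (l : ℤ → Ω → BNB.PosReal),
        BNB.IsDrivenSolution r α g P u y l ∧
        BNB.IsSolution r α g P y l ∧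
        BNB.IsCausal P u (BNB.pair y l) ∧
        BNB.StrictlyStationary P (BNB.pair y l) ∧
        BNB.ErgodicProcess P (BNB.pair y l) ∧
        (∀ t : ℤ, Integrable (fun ω => (y t ω : ℝ)) P) ∧
        ∀ (y' : ℤ → Ω → ℕ) (l' : ℤ → Ω → BNB.PosReal),
          BNB.IsDrivenSolution r α g P u y' l' → BNB.IsCausal P u (BNB.pair y' l') →
          BNB.StrictlyStationary P (BNB.pair y' l') →
          ∀ᵐ ω ∂P, ∀ t : ℤ, y' t ω = y t ω ∧ l' t ω = l t ω) ∧
    -- (ii) in every strictly stationary solution `l t` is one and the same measurable function of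
    -- the past observations `y (t - 1), y (t - 2), …`
    (∃ gInf : (ℕ → ℕ) → BNB.PosReal, Measurable gInf ∧
      ∀ (Ω : Type w) [MeasurableSpace Ω] (P : Measure Ω) [IsProbabilityMeasure P]
        (y : ℤ → Ω → ℕ) (l : ℤ → Ω → BNB.PosReal),
        BNB.IsSolution r α g P y l → BNB.StrictlyStationary P (BNB.pair y l) →
        ∀ t : ℤ, ∀ᵐ ω ∂P, l t ω = gInf (fun n : ℕ => y (t - 1 - n) ω)) := by
  have hlip : BNB.LipschitzPair g c₁ c₂ := hg
  have hc₂' : c₂ < 1 := by linarith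
  obtain ⟨h, hh, hint, hrec⟩ := BNB.exists_mean_function hr hα hlip hc₁ hc₂ hc hg0
  have hH := BNB.measurable_causalPair hr hα hh
  -- the solution driven by the coordinate process of `ℝ ^ ℤ`
  have hu₀ := BNB.isIIDUniform_coord
  have hsol₀ := BNB.isSolution_causal hr hα hu₀ hlip hc₂ hc₂' hh hint hrec
  have hst₀ : BNB.StrictlyStationary _ (BNB.pair (BNB.causalObs r α h _) _) :=
    hu₀.strictlyStationary hH
  have hpm₀ := BNB.isPastMean_causal hr hα hu₀ hlip hc₂ hc₂' hh hint hrec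
  have hX₀ := BNB.measurable_path hsol₀
  refine ⟨⟨_, Measure.isProbabilityMeasure_map hX₀.aemeasurable,
    hsol₀.pathLaw hr hα hlip hpm₀, hst₀.pathLaw (BNB.measurable_pair hsol₀), ?_, fun t => ?_, ?_⟩,
    ?_, ?_⟩
  · have he := hu₀.ergodicProcess hH
    unfold BNB.ErgodicProcess
    rw [BNB.pathLaw_coord]
    exact he
  · have hm : Measurable fun x : ℤ → ℕ × BNB.PosReal => ((x t).1 : ℝ) :=
      measurable_from_top.comp (BNB.measurable_coord_fst t)
    exact (integrable_map_measure hm.aestronglyMeasurable hX₀.aemeasurable).2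
      (BNB.integrable_causalObs hr hα hu₀ hh hint t)
  · intro Ω _ P _ y l hsol hst
    exact hsol.pathLaw_eq hr hα hlip hc₁ hc₂ hc hst hsol₀ hst₀
  · intro Ω _ P _ u hu
    refine ⟨_, _, BNB.isDrivenSolution_causal hr hα hu hh hrec,
      BNB.isSolution_causal hr hα hu hlip hc₂ hc₂' hh hint hrec,
      ⟨_, hH, fun t => Filter.Eventually.of_forall fun ω => rfl⟩, hu.strictlyStationary hH,
      hu.ergodicProcess hH, BNB.integrable_causalObs hr hα hu hh hint, ?_⟩
    intro y' l' hdr hcausal _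
    exact BNB.ae_eq_causal hr hα hu hlip hc₁ hc₂ hc hh hrec hdr hcausal
  · refine ⟨BNB.pastMean g, BNB.measurable_pastMean hlip, ?_⟩
    intro Ω _ P _ y l hsol hst t
    -- all stationary solutions share the law of the canonical one, where the identity holds
    have hset := BNB.measurableSet_eq_pastMean hlip t
    have h₀ := (ae_map_iff hX₀.aemeasurable hset).2 (hpm₀ t).ae_eq
    have hlaw := hsol.pathLaw_eq hr hα hlip hc₁ hc₂ hc hst hsol₀ hst₀
    simp only [BNB.pathLaw] at hlaw
    rw [← hlaw] at h₀
    exact (ae_map_iff (BNB.measurable_path hsol).aemeasurable hset).1 h₀
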